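/- **Setting.** A *system* is a probability space $\mathcal X=(X,\mathcal B,\mu)$ with a measure-preserving action of $\mathbb Z^d$; $R\in\mathbb Z^d$ acts on real-valued functions by $(Rf)(x)=f(Rx)$. A *factor* is a $\mathbb Z^d$-invariant sub-$\sigma$-algebra $\mathcal Y\subseteq\mathcal B$, and $\|f\|_{y}=\big(E(f^2\mid\mathcal Y)(y)\big)^{1/2}$. For a subgroup $\Gamma\subseteq\mathbb Z^d$, a function $f\in L^2(\mathcal X)$ is *$\Gamma$-compact relative to $\mathcal Y$* if for all $\epsilon,\delta>0$ there are $B\in\mathcal Y$ with $\mu(B)>1-\epsilon$ and $h_1,\dots,h_k\in L^2(\mathcal X)$ such that for each $R\in\Gamma$, $\min_{l}\|R(f\chi_B)-h_l\|_y<\delta$ for almost every $y\in B$. A *tower of $\Gamma$-compact extensions* of height $\eta$ ($\eta$ an ordinal) is a family of factors $(\mathcal Y_\delta)_{\delta<\eta}$ which is increasing, satisfies that $\mathcal Y_\lambda$ is generated by $\bigcup_{\beta<\lambda}\mathcal Y_\beta$ for every limit ordinal $\lambda<\eta$, and is such that whenever $\beta+1<\eta$, every function that is $\Gamma$-compact relative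 to $\mathcal Y_\beta$ is $\mathcal Y_{\beta+1}$-measurable (modulo null sets). For an ordinal $\alpha$, an *$\alpha$-sequence* is a strictly increasing sequence of ordinals $s=(s_\beta)_{\beta\le\alpha}$. An *$\alpha$-subsequence* of a sequence $s$ is an $\alpha$-sequence that is a subsequence of $s$. A property $P(\delta)$ *holds for $s$-many $\delta$* if for every $\beta<\alpha$ there is $\delta$ with $s_\beta<\delta\le s_{\beta+1}$ such that $P(\delta)$ holds. **Theorem.** For every $\epsilon>0$ and $B>0$ there is a natural number $K$ such that for every $d$, every $\mathbb Z^d$-system $\mathcal X$, every subgroup $\Gamma\subseteq\mathbb Z^d$, every $T\in\mathbb Z^d\setminus\Gamma$, every tower $(\mathcal Y_\delta)_{\delta<\eta}$ of $\langle\Gamma\cup\{T\}\rangle$-compact extensions (where $\langle\Gamma\cup\{T\}\rangle$ is the subgroup generated by $\Gamma$ and $T$), every ordinal $\alpha\ge\omega$, every $\alpha^K$-sequence $s$ of ordinals less than $\eta$, and all $f,g$ that are $\Gamma$-compact relative to $\mathcal Y_0$ with $\|f\|_\infty,\|g\|_\infty\le B$, there are a natural number $n$ and an $\alpha$-subsequence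 $t$ of $s$ such that, for $t$-many $\delta$, the following holds: for every $m\ge n$, \[\frac1m\sum_{i<m}\int\left[E(f\,T^{-i}g\mid\mathcal Y_\delta)-E(f\mid\mathcal Y_\delta)\,T^{-i}E(g\mid\mathcal Y_\delta)\right]^2d\mu<\epsilon .\] (For $m=0$ the left-hand side is read as $0$.) -/

import Mathlib

open MeasureTheory

universe u v

namespace ErgodicTower

section Factors

variable {X : Type u} {d : ℕ} [AddAction (Fin d → ℤ) X]

/-- The action of `v ∈ ℤ^d` on functions: `(v f)(x) = f (v x)`. -/
def translate (v : Fin d → ℤ) (f : X → ℝ) : X → ℝ := fun x => f (v +ᵥ x)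

/-- A factor of a `ℤ^d`-system, given as an invariant sub-σ-algebra. -/
structure IsFactor [mX : MeasurableSpace X] (d : ℕ) [AddAction (Fin d → ℤ) X] (m : MeasurableSpace X) : Prop where
  le : m ≤ mX
  invariant : ∀ v : Fin d → ℤ, Measurable[m, m] (fun x : X => v +ᵥ x)

/-- The fibre norm `‖f‖_y = (E(f² ∣ Y)(y))^{1/2}` of `L²(X)` relative to the factor `m`,
as a function on `X` (defined almost everywhere, and measurable with respect to `m`). -/
noncomputable def fibreNorm {mX : MeasurableSpace X} (μ : Measure X)
    (m : MeasurableSpace X) (f : X → ℝ) (x : X) : ℝ :=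
  Real.sqrt ((μ[fun z => f z ^ 2 | m]) x)

/-- `f ∈ L²(X)` is compact relative to the factor `m` with respect to the group `Γ`. -/
def IsCompactRel {mX : MeasurableSpace X} (μ : Measure X) (Γ : AddSubgroup (Fin d → ℤ))
    (m : MeasurableSpace X) (f : X → ℝ) : Prop :=
  MemLp f 2 μ ∧
    ∀ ε : ℝ, 0 < ε → ∀ δ : ℝ, 0 < δ →
      ∃ B : Set X, MeasurableSet[m] B ∧ 1 - ε < μ.real B ∧
        ∃ (k : ℕ) (h : Fin k → X → ℝ), (∀ l, MemLp (h l) 2 μ) ∧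
          ∀ R ∈ Γ, ∀ᵐ y ∂μ, y ∈ B →
            ∃ l, fibreNorm μ m (translate R (B.indicator f) - h l) y < δ

/-- `(Y δ)_{δ < η}` is an increasing tower of factors of height `η`, continuous at limits. Only
the values `Y δ` with `δ < η` matter. -/
structure IsTower [MeasurableSpace X] (d : ℕ)
    [AddAction (Fin d → ℤ) X] (η : Ordinal.{v})
    (Y : Ordinal.{v} → MeasurableSpace X) : Prop where
  factor : ∀ δ < η, IsFactor d (Y δ)
  mono : ∀ β γ, β < γ → γ < η → Y β ≤ Y γ
  limit : ∀ l < η, Order.IsSuccLimit l → Y l = ⨆ β : Set.Iio l, Y β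

/-- `(Y δ)_{δ < η}` is a tower of `Γ`-compact extensions: every function that is compact relative
to `Y β` with respect to `Γ` is, modulo null sets, measurable with respect to `Y (β + 1)`. -/
structure IsCompactTower [MeasurableSpace X] (μ : Measure X) (Γ : AddSubgroup (Fin d → ℤ))
    (η : Ordinal.{v}) (Y : Ordinal.{v} → MeasurableSpace X) : Prop extends IsTower d η Y where
  compact_le : ∀ β, β + 1 < η → ∀ f : X → ℝ, IsCompactRel μ Γ (Y β) f →
    AEStronglyMeasurable[Y (β + 1)] f μ

end Factors

section Sequences

/-- `s` is an `α`-sequence: strictly increasing on the ordinals `≤ α`. Only these values matter. -/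
def IsSeq (α : Ordinal.{v}) (s : Ordinal.{v} → Ordinal.{v}) : Prop :=
  StrictMonoOn s (Set.Iic α)

/-- `t` is a `β`-subsequence of the `α`-sequence `s`. -/
def IsSubseq (β : Ordinal.{v}) (t : Ordinal.{v} → Ordinal.{v}) (α : Ordinal.{v})
    (s : Ordinal.{v} → Ordinal.{v}) : Prop :=
  IsSeq β t ∧ ∀ b ≤ β, ∃ a ≤ α, t b = s a

/-- `P` holds for `s`-many `δ`, where `s` is an `α`-sequence. -/
def HoldsForMany (α : Ordinal.{v}) (s : Ordinal.{v} → Ordinal.{v})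
    (P : Ordinal.{v} → Prop) : Prop :=
  ∀ β < α, ∃ δ ∈ Set.Ioc (s β) (s (β + 1)), P δ

end Sequences

end ErgodicTower

namespace ErgodicTower

/-! The exponent is K = 2, and the proof is an energy increment argument combined with relative weak
mixing. The energies ∫ E(g | Y_β)² increase with β and are bounded by B². Since α ≥ ω, any finite
number N of consecutive blocks of length α + 1 fits into α² (`add_one_mul_nat_le_sq`), so on some
block, from s_a to s_{a+α+1}, the energy grows by less than ε/(4B²). The subsequence t is s
restricted to that block.

Put l = s_{a+α}; then l + 1 is still inside the block. The function g' = g − E(g | Y_{l+1}) is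
orthogonal to everything ⟨Γ,T⟩-compact relative to Y_l, so it is relatively weakly mixing: convex
combinations of translates of g' ⊗ g' come arbitrarily close to 0 in the relative Hilbert–Schmidt
norm (`exists_convexWeights_gramForm_lt`). As f is Γ-compact, the averages of ∫ E(f T^{-i}g' | Y_l)²
tend to 0 (`exists_average_relCorr_lt`). For every δ ≤ l in the block, `integral_sq_corr_le` bounds
the correlation over Y_δ by the one of f and g' over Y_l plus the energy gap. Hence one n, chosen
for l, serves all δ at once.

The weak mixing step takes a minimizing sequence of convex weights for the Hilbert–Schmidt form. By
the parallelogram law it is Cauchy, and asymptotically invariant under translation; the associated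
kernel operators applied to g' therefore converge to a relatively compact φ
(`isCompactRel_of_minimizing`). Orthogonality of g' and φ says that the minimizers are
asymptotically orthogonal to g' ⊗ g', a point of the convex set, which forces the infimum to be 0.
Working with finitely supported weights and the form `gramForm` keeps all of this inside linear
algebra and L². -/

/-- `u` is almost everywhere strongly measurable and almost everywhere bounded by `C`. -/
structure AEBdd {X : Type*} {mX : MeasurableSpace X} (μ : Measure X) (C : ℝ) (u : X → ℝ) :
    Prop where
  aesm : AEStronglyMeasurable u μ
  bound : ∀ᵐ x ∂μ, |u x| ≤ C

/-! ### Bounded functions and L² estimates for conditional expectations. -/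

section CondExp

variable {X : Type*} {mX : MeasurableSpace X} {μ : Measure X} {m m₁ m₂ : MeasurableSpace X}
  {C D : ℝ} {a b u v : X → ℝ}

lemma AEBdd.mono (hu : AEBdd μ C u) (h : C ≤ D) : AEBdd μ D u :=
  ⟨hu.aesm, hu.bound.mono fun _ hx => hx.trans h⟩

lemma AEBdd.add (hu : AEBdd μ C u) (hv : AEBdd μ D v) : AEBdd μ (C + D) (u + v) := by
  refine ⟨hu.aesm.add hv.aesm, ?_⟩
  filter_upwards [hu.bound, hv.bound] with x h1 h2
  exact (abs_add_le _ _).trans (add_le_add h1 h2)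

lemma AEBdd.neg (hu : AEBdd μ C u) : AEBdd μ C (-u) :=
  ⟨hu.aesm.neg, by simpa using hu.bound⟩

lemma AEBdd.sub (hu : AEBdd μ C u) (hv : AEBdd μ D v) : AEBdd μ (C + D) (u - v) := by
  rw [sub_eq_add_neg]; exact hu.add hv.neg

lemma AEBdd.const_mul (hu : AEBdd μ C u) (r : ℝ) : AEBdd μ (|r| * C) (fun x => r * u x) := by
  refine ⟨hu.aesm.const_mul r, ?_⟩
  filter_upwards [hu.bound] with x h1
  rw [abs_mul]
  exact mul_le_mul_of_nonneg_left h1 (abs_nonneg _)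

lemma AEBdd.const_smul (hu : AEBdd μ C u) (r : ℝ) : AEBdd μ (|r| * C) (r • u) := hu.const_mul r

lemma AEBdd.condExp (hm : m ≤ mX) (hu : AEBdd μ C u) : AEBdd μ C (μ[u | m]) :=
  ⟨(stronglyMeasurable_condExp.mono hm).aestronglyMeasurable, ae_bdd_abs_condExp_of_ae_bdd_abs hu.bound⟩

lemma AEBdd.finsetSum {ι : Type*} {s : Finset ι} {C : ι → ℝ} {u : ι → X → ℝ}
    (h : ∀ i ∈ s, AEBdd μ (C i) (u i)) : AEBdd μ (∑ i ∈ s, C i) (∑ i ∈ s, u i) := by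
  classical
  induction s using Finset.induction_on with
  | empty => exact ⟨aestronglyMeasurable_const (b := (0 : ℝ)), by simp⟩
  | insert i s hi ih =>
    rw [Finset.sum_insert hi, Finset.sum_insert hi]
    exact (h i (by simp)).add (ih fun j hj => h j (by simp [hj]))

lemma AEBdd.sub_condExp (hm : m ≤ mX) (hu : AEBdd μ C u) : AEBdd μ (2 * C) (u - μ[u | m]) := by
  rw [two_mul]; exact hu.sub (hu.condExp hm)

lemma aeBdd_of_eLpNorm_top_le (hu : MemLp u 2 μ) (hC : 0 ≤ C)
    (h : eLpNorm u ⊤ μ ≤ ENNReal.ofReal C) : AEBdd μ C u := by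
  refine ⟨hu.aestronglyMeasurable, ?_⟩
  filter_upwards [ae_le_eLpNormEssSup (f := u) (μ := μ)] with x hx
  rw [eLpNorm_exponent_top] at h
  have := hx.trans h
  rw [← ofReal_norm, ENNReal.ofReal_le_ofReal_iff hC] at this
  simpa using this

lemma integral_sq_add_le (ha : MemLp a 2 μ) (hb : MemLp b 2 μ) :
    ∫ x, (a x + b x) ^ 2 ∂μ ≤ 2 * ∫ x, a x ^ 2 ∂μ + 2 * ∫ x, b x ^ 2 ∂μ := by
  rw [← integral_const_mul, ← integral_const_mul,
    ← integral_add (ha.integrable_sq.const_mul 2) (hb.integrable_sq.const_mul 2)]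
  exact integral_mono (ha.add hb).integrable_sq
    ((ha.integrable_sq.const_mul 2).add (hb.integrable_sq.const_mul 2))
    fun x => by simp only; nlinarith [sq_nonneg (a x - b x)]

lemma abs_integral_mul_le (ha : MemLp a 2 μ) (hb : MemLp b 2 μ) :
    |∫ x, a x * b x ∂μ| ≤ √(∫ x, a x ^ 2 ∂μ) * √(∫ x, b x ^ 2 ∂μ) := by
  have i1 : Integrable (fun x => a x * b x) μ := ha.integrable_mul hb
  rw [← Real.sqrt_mul (integral_nonneg fun x => sq_nonneg _)]
  apply Real.abs_le_sqrt
  have h : ∀ t : ℝ, 0 ≤ (∫ x, a x ^ 2 ∂μ) * (t * t) + (2 * ∫ x, a x * b x ∂μ) * t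
      + ∫ x, b x ^ 2 ∂μ := fun t => by
    have h0 : 0 ≤ ∫ x, (t * a x + b x) ^ 2 ∂μ := integral_nonneg fun x => sq_nonneg _
    have e : ∀ x, (t * a x + b x) ^ 2 = (t * t) * a x ^ 2 + 2 * t * (a x * b x) + b x ^ 2 :=
      fun x => by ring
    simp only [e] at h0
    rw [integral_add (f := fun x => (t * t) * a x ^ 2 + 2 * t * (a x * b x))
      ((ha.integrable_sq.const_mul _).add (i1.const_mul _)) hb.integrable_sq,
      integral_add (ha.integrable_sq.const_mul _) (i1.const_mul _), integral_const_mul,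
      integral_const_mul] at h0
    linarith
  have := discrim_le_zero h
  rw [discrim] at this
  nlinarith

variable [IsProbabilityMeasure μ]

lemma AEBdd.nonneg (hu : AEBdd μ C u) : 0 ≤ C := by
  obtain ⟨x, hx⟩ := hu.bound.exists
  exact (abs_nonneg _).trans hx

lemma AEBdd.mul (hu : AEBdd μ C u) (hv : AEBdd μ D v) : AEBdd μ (C * D) (u * v) := by
  refine ⟨hu.aesm.mul hv.aesm, ?_⟩
  have := hu.nonneg
  filter_upwards [hu.bound, hv.bound] with x h1 h2
  rw [Pi.mul_apply, abs_mul]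
  exact mul_le_mul h1 h2 (abs_nonneg _) this

lemma AEBdd.pow_two (hu : AEBdd μ C u) : AEBdd μ (C ^ 2) (u ^ 2) := by
  rw [sq, sq]; exact hu.mul hu

lemma AEBdd.memLp (hu : AEBdd μ C u) (p : ENNReal) : MemLp u p μ :=
  MemLp.of_bound hu.aesm C (by simpa using hu.bound)

lemma AEBdd.integrable (hu : AEBdd μ C u) : Integrable u μ :=
  (hu.memLp 1).integrable le_rfl

lemma AEBdd.integral_le (hu : AEBdd μ C u) : ∫ x, u x ∂μ ≤ C := by
  have := integral_mono_ae hu.integrable (integrable_const C)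
    (hu.bound.mono fun x hx => (le_abs_self _).trans hx)
  simpa using this

lemma sq_condExp_le (hm : m ≤ mX) (hu : MemLp u 2 μ) :
    (fun x => (μ[u | m]) x ^ 2) ≤ᵐ[μ] μ[u ^ 2 | m] := by
  have h := ConvexOn.map_condExp_le_univ (φ := fun x : ℝ => x ^ 2) (f := u) hm (even_two.convexOn_pow)
    (continuous_pow 2).lowerSemicontinuous (hu.integrable (by norm_num)) hu.integrable_sq
  exact h

lemma integral_sq_condExp_le (hm : m ≤ mX) (hu : MemLp u 2 μ) :
    ∫ x, (μ[u | m]) x ^ 2 ∂μ ≤ ∫ x, u x ^ 2 ∂μ := by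
  calc _ ≤ ∫ x, (μ[u ^ 2 | m]) x ∂μ :=
        integral_mono_ae (hu.condExp (by norm_num)).integrable_sq integrable_condExp
          (sq_condExp_le hm hu)
    _ = _ := integral_condExp hm

lemma integral_sq_condExp_mono (h12 : m₁ ≤ m₂) (hm : m₂ ≤ mX) (hu : MemLp u 2 μ) :
    ∫ x, (μ[u | m₁]) x ^ 2 ∂μ ≤ ∫ x, (μ[u | m₂]) x ^ 2 ∂μ := by
  have h := condExp_condExp_of_le (μ := μ) (f := u) h12 hm
  calc _ = ∫ x, (μ[μ[u | m₂] | m₁]) x ^ 2 ∂μ :=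
        integral_congr_ae (h.mono fun x hx => by simp only [hx])
    _ ≤ _ := integral_sq_condExp_le (h12.trans hm) (hu.condExp (by norm_num))

lemma integral_mul_condExp (hm : m ≤ mX) (hu : MemLp u 2 μ) (hv : MemLp v 2 μ) :
    ∫ x, u x * (μ[v | m]) x ∂μ = ∫ x, (μ[u | m]) x * (μ[v | m]) x ∂μ := by
  have h := condExp_mul_of_aestronglyMeasurable_right (m := m) (μ := μ) (f := u) (g := μ[v | m])
    stronglyMeasurable_condExp.aestronglyMeasurable
    (hu.integrable_mul (hv.condExp (by norm_num))) (hu.integrable (by norm_num))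
  rw [← integral_condExp hm]
  exact integral_congr_ae h

/-- Pythagoras for nested orthogonal projections; this turns a small energy increment into L²
closeness. -/
lemma integral_sq_condExp_sub (h12 : m₁ ≤ m₂) (hm : m₂ ≤ mX) (hu : MemLp u 2 μ) :
    ∫ x, ((μ[u | m₂]) x - (μ[u | m₁]) x) ^ 2 ∂μ =
      ∫ x, (μ[u | m₂]) x ^ 2 ∂μ - ∫ x, (μ[u | m₁]) x ^ 2 ∂μ := by
  have h2 : MemLp (μ[u | m₂]) 2 μ := hu.condExp (by norm_num)
  have h1 : MemLp (μ[u | m₁]) 2 μ := hu.condExp (by norm_num)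
  have hc := condExp_condExp_of_le (μ := μ) (f := u) h12 hm
  have h : ∫ x, (μ[u | m₂]) x * (μ[u | m₁]) x ∂μ = ∫ x, (μ[u | m₁]) x ^ 2 ∂μ := by
    rw [integral_mul_condExp (h12.trans hm) h2 hu]
    exact integral_congr_ae (hc.mono fun x hx => by simp only [hx, sq])
  have e : ∀ x, ((μ[u | m₂]) x - (μ[u | m₁]) x) ^ 2 =
      (μ[u | m₂]) x ^ 2 - 2 * ((μ[u | m₂]) x * (μ[u | m₁]) x) + (μ[u | m₁]) x ^ 2 :=
    fun x => by ring
  simp only [e]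
  have i1 : Integrable (fun x => (μ[u | m₂]) x * (μ[u | m₁]) x) μ := h2.integrable_mul h1
  rw [integral_add (f := fun x => (μ[u | m₂]) x ^ 2 - 2 * ((μ[u | m₂]) x * (μ[u | m₁]) x))
    (h2.integrable_sq.sub (i1.const_mul 2)) h1.integrable_sq, integral_sub h2.integrable_sq (i1.const_mul 2), integral_const_mul, h]
  ring

end CondExp

/-! ### The action on functions and its commutation with conditional expectation. -/

section Translate

variable {X : Type*} {d : ℕ} {m mX : MeasurableSpace X} [AddAction (Fin d → ℤ) X]

@[simp] lemma translate_apply (r : Fin d → ℤ) (f : X → ℝ) (x : X) :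
    translate r f x = f (r +ᵥ x) := rfl

lemma translate_add (r s : Fin d → ℤ) (f : X → ℝ) :
    translate r (translate s f) = translate (r + s) f := by
  ext x
  simp only [translate_apply, vadd_vadd, add_comm]

@[simp] lemma translate_zero (f : X → ℝ) : translate (0 : Fin d → ℤ) f = f := by
  ext x; simp

lemma translate_mul (r : Fin d → ℤ) (f g : X → ℝ) :
    translate r (f * g) = translate r f * translate r g := rfl

lemma translate_sub (r : Fin d → ℤ) (f g : X → ℝ) :
    translate r (f - g) = translate r f - translate r g := rfl

lemma stronglyMeasurable_translate (hm : IsFactor d m) (r : Fin d → ℤ)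
    (hu : StronglyMeasurable[m] u) : StronglyMeasurable[m] (translate r u) :=
  hu.comp_measurable (hm.invariant r)

variable {μ : Measure X} [MeasurableConstVAdd (Fin d → ℤ) X] [VAddInvariantMeasure (Fin d → ℤ) X μ]
  {C : ℝ} {u v : X → ℝ}

lemma AEBdd.translate (hu : AEBdd μ C u) (r : Fin d → ℤ) : AEBdd μ C (translate r u) :=
  ⟨hu.aesm.comp_measurePreserving (measurePreserving_vadd r μ),
    (measurePreserving_vadd r μ).quasiMeasurePreserving.ae hu.bound⟩

lemma memLp_translate (hu : MemLp u 2 μ) (r : Fin d → ℤ) : MemLp (translate r u) 2 μ :=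
  hu.comp_measurePreserving (measurePreserving_vadd r μ)

lemma integral_translate (r : Fin d → ℤ) (u : X → ℝ) :
    ∫ x, translate r u x ∂μ = ∫ x, u x ∂μ :=
  (measurePreserving_vadd r μ).integral_comp (measurableEmbedding_const_vadd r) u

lemma integral_translate_sq (r : Fin d → ℤ) (u : X → ℝ) :
    ∫ x, translate r u x ^ 2 ∂μ = ∫ x, u x ^ 2 ∂μ :=
  integral_translate r (fun x => u x ^ 2)

lemma condExp_translate [IsFiniteMeasure μ] (hm : IsFactor d m) (r : Fin d → ℤ)
    (hu : Integrable u μ) :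
    μ[translate r u | m] =ᵐ[μ] translate r (μ[u | m]) := by
  have hmp := measurePreserving_vadd r μ
  have hme : MeasurableEmbedding (fun x : X => r +ᵥ x) := measurableEmbedding_const_vadd r
  symm
  have hi : Integrable (translate r (μ[u | m])) μ :=
    hmp.integrable_comp_of_integrable integrable_condExp
  refine ae_eq_condExp_of_forall_setIntegral_eq hm.le (hmp.integrable_comp_of_integrable hu)
    (fun s _ _ => hi.integrableOn) (fun s hs _ => ?_)
    (stronglyMeasurable_translate hm r stronglyMeasurable_condExp).aestronglyMeasurable
  have hs' : MeasurableSet[m] ((fun x : X => (-r) +ᵥ x) ⁻¹' s) := hm.invariant (-r) hs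
  have e : s = (fun x : X => r +ᵥ x) ⁻¹' ((fun x : X => (-r) +ᵥ x) ⁻¹' s) := by
    ext x; simp
  rw [e]
  simp only [translate_apply]
  rw [hmp.setIntegral_preimage_emb hme, hmp.setIntegral_preimage_emb hme, setIntegral_condExp hm.le hu hs']

end Translate

/-! ### Relative Hilbert–Schmidt kernels and their operator bound. -/

section Kernel

variable {X : Type*} {mX : MeasurableSpace X} {μ : Measure X} {m : MeasurableSpace X}

open Matrix in
/-- A measurable family of matrices whose quadratic form is almost everywhere nonnegative at each
fixed vector is almost everywhere positive semidefinite. -/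
lemma ae_posSemidef {J : Type*} [Fintype J] {M : X → Matrix J J ℝ}
    (hsymm : ∀ y, (M y).IsHermitian)
    (h : ∀ x : J → ℝ, ∀ᵐ y ∂μ, 0 ≤ x ⬝ᵥ (M y) *ᵥ x) : ∀ᵐ y ∂μ, (M y).PosSemidef := by
  -- Countably many test vectors suffice: the exceptional null sets can be united, and continuity of
  -- the quadratic form extends positivity from a dense sequence to all vectors.
  have h' : ∀ᵐ y ∂μ, ∀ n : ℕ,
      0 ≤ TopologicalSpace.denseSeq (J → ℝ) n ⬝ᵥ (M y) *ᵥ TopologicalSpace.denseSeq (J → ℝ) n :=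
    ae_all_iff.2 fun n => h _
  filter_upwards [h'] with y hy
  refine Matrix.PosSemidef.of_dotProduct_mulVec_nonneg (hsymm y) fun x => ?_
  have hc : Continuous fun x : J → ℝ => x ⬝ᵥ (M y) *ᵥ x := by fun_prop
  have hcl : IsClosed {x : J → ℝ | 0 ≤ x ⬝ᵥ (M y) *ᵥ x} := isClosed_le continuous_const hc
  have hsub : Set.range (TopologicalSpace.denseSeq (J → ℝ)) ⊆ {x : J → ℝ | 0 ≤ x ⬝ᵥ (M y) *ᵥ x} := by
    rintro _ ⟨n, rfl⟩; exact hy n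
  have := hcl.closure_subset_iff.2 hsub
  rw [(TopologicalSpace.denseRange_denseSeq (J → ℝ)).closure_range] at this
  simpa using this (Set.mem_univ x)

lemma condExp_sum_smul {J : Type*} (s : Finset J) (x : J → ℝ) {f : J → X → ℝ}
    (hf : ∀ i ∈ s, Integrable (f i) μ) :
    μ[∑ i ∈ s, x i • f i | m] =ᵐ[μ] fun y => ∑ i ∈ s, x i * (μ[f i | m]) y := by
  have h1 := condExp_finsetSum (μ := μ) (s := s) (f := fun i => x i • f i)
    (fun i hi => (hf i hi).smul (x i)) m
  have h2 : ∀ᵐ y ∂μ, ∀ i ∈ s, (μ[x i • f i | m]) y = x i * (μ[f i | m]) y :=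
    (Finset.eventually_all s).2 fun i _ => condExp_smul (x i) (f i) m
  filter_upwards [h1, h2] with y hy1 hy2
  rw [hy1, Finset.sum_apply]
  exact Finset.sum_congr rfl hy2

/-- The relative Hilbert–Schmidt operator with kernel `∑ i, w i • u i ⊗ u i` over the factor `m`. -/
noncomputable def kernelOp (μ : Measure X) (m : MeasurableSpace X) {ι : Type*} (u : ι → X → ℝ)
    (ψ : X → ℝ) : (ι →₀ ℝ) →ₗ[ℝ] (X → ℝ) :=
  Finsupp.linearCombination ℝ fun i => u i * μ[u i * ψ | m]

/-- The bilinear form on finitely supported functions with matrix `c`. -/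
noncomputable def finsuppForm {ι : Type*} (c : ι → ι → ℝ) : (ι →₀ ℝ) →ₗ[ℝ] (ι →₀ ℝ) →ₗ[ℝ] ℝ :=
  Finsupp.linearCombination ℝ fun i => (Finsupp.linearCombination ℝ (c i) : (ι →₀ ℝ) →ₗ[ℝ] ℝ)

lemma finsuppForm_apply {ι : Type*} (c : ι → ι → ℝ) (v w : ι →₀ ℝ) :
    finsuppForm c v w = ∑ i ∈ v.support, ∑ j ∈ w.support, v i * w j * c i j := by
  simp only [finsuppForm, Finsupp.linearCombination_apply, Finsupp.sum, LinearMap.sum_apply,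
    LinearMap.smul_apply, smul_eq_mul, Finset.mul_sum, mul_assoc]

lemma finsuppForm_comm {ι : Type*} {c : ι → ι → ℝ} (hc : ∀ i j, c i j = c j i) (v w : ι →₀ ℝ) :
    finsuppForm c v w = finsuppForm c w v := by
  rw [finsuppForm_apply, finsuppForm_apply, Finset.sum_comm]
  refine Finset.sum_congr rfl fun i _ => Finset.sum_congr rfl fun j _ => ?_
  rw [hc]; ring

/-- The matrix `(i, j) ↦ E(u i * u j ∣ m)(y) ^ 2` of relative Hilbert–Schmidt inner products. -/
noncomputable def gramSq (μ : Measure X) (m : MeasurableSpace X) {ι : Type*} (u : ι → X → ℝ)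
    (y : X) (i j : ι) : ℝ := (μ[u i * u j | m]) y ^ 2

lemma gramSq_comm {ι : Type*} (u : ι → X → ℝ) (y : X) (i j : ι) :
    gramSq μ m u y i j = gramSq μ m u y j i := by
  rw [gramSq, gramSq, mul_comm]

lemma kernelOp_apply (w : ι →₀ ℝ) :
    kernelOp μ m u ψ w = ∑ i : w.support, w i • (u i * μ[u i * ψ | m]) := by
  rw [kernelOp, Finsupp.linearCombination_apply, Finsupp.sum,
    Finset.sum_coe_sort w.support fun i => w i • (u i * μ[u i * ψ | m])]

/-- The integrated Hilbert–Schmidt inner products `∫ E(u i * u j ∣ m) ^ 2`. -/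
noncomputable def gramForm (μ : Measure X) (m : MeasurableSpace X) {ι : Type*} (u : ι → X → ℝ) :
    (ι →₀ ℝ) →ₗ[ℝ] (ι →₀ ℝ) →ₗ[ℝ] ℝ :=
  finsuppForm fun i j => ∫ y, gramSq μ m u y i j ∂μ

lemma gramForm_comm (v w : ι →₀ ℝ) : gramForm μ m u v w = gramForm μ m u w v :=
  finsuppForm_comm (fun i j => by simp only [gramSq_comm]) v w

variable [IsProbabilityMeasure μ] {C D : ℝ}

section Fintype

variable {J : Type*} [Fintype J] {u : J → X → ℝ} {ψ : X → ℝ}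

lemma condExp_sq_sum_smul (hu : ∀ i, AEBdd μ C (u i)) (x : J → ℝ) :
    μ[(∑ i, x i • u i) ^ 2 | m] =ᵐ[μ]
      fun y => ∑ i, ∑ j, x i * x j * (μ[u i * u j | m]) y := by
  have e : (∑ i, x i • u i) ^ 2 = ∑ p : J × J, (x p.1 * x p.2) • (u p.1 * u p.2) := by
    rw [sq, Finset.sum_mul_sum, Fintype.sum_prod_type]
    refine Finset.sum_congr rfl fun i _ => Finset.sum_congr rfl fun j _ => ?_
    ext y; simp; ring
  rw [e]
  filter_upwards [condExp_sum_smul (μ := μ) (m := m) Finset.univ (fun p : J × J => x p.1 * x p.2)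
    (f := fun p => u p.1 * u p.2) fun p _ => ((hu p.1).mul (hu p.2)).integrable] with y hy
  rw [hy, Fintype.sum_prod_type]

lemma condExp_mul_sq_le (hm : m ≤ mX) {U : X → ℝ} (hU : AEBdd μ D U) (hψ : AEBdd μ C ψ) :
    ∀ᵐ y ∂μ, (μ[U * ψ | m]) y ^ 2 ≤ C ^ 2 * (μ[U ^ 2 | m]) y := by
  have h1 := sq_condExp_le (m := m) hm ((hU.mul hψ).memLp 2)
  have h2 : μ[(U * ψ) ^ 2 | m] ≤ᵐ[μ] μ[(C ^ 2) • U ^ 2 | m] := by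
    refine condExp_mono (hU.mul hψ).pow_two.integrable (hU.pow_two.const_smul _).integrable ?_
    filter_upwards [hψ.bound] with y hy
    have : ψ y ^ 2 ≤ C ^ 2 := sq_le_sq.2 (hy.trans (le_abs_self C))
    simp only [Pi.pow_apply, Pi.mul_apply, Pi.smul_apply, smul_eq_mul, mul_pow]
    nlinarith [sq_nonneg (U y)]
  have h3 := condExp_smul (μ := μ) (C ^ 2) (U ^ 2) m
  filter_upwards [h1, h2, h3] with y h1 h2 h3
  exact h1.trans (h2.trans h3.le)

-- Schur's product theorem. With G = (E(u_i u_j | m)) and p_i = E(u_i ψ | m), both G and C²G − p pᵀ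
-- are positive semidefinite, the latter by conditional Jensen and |ψ| ≤ C. Their entrywise product
-- is positive semidefinite, and testing it on v gives the bound. The coefficients v may have any
-- sign, which matters because it is applied to differences of weights.
open Matrix in
lemma ae_quadratic_le (hm : m ≤ mX) (hu : ∀ i, AEBdd μ D (u i)) (hψ : AEBdd μ C ψ) (v : J → ℝ) :
    ∀ᵐ y ∂μ, ∑ i, ∑ j, v i * v j *
        ((μ[u i * ψ | m]) y * (μ[u j * ψ | m]) y * (μ[u i * u j | m]) y) ≤
      C ^ 2 * ∑ i, ∑ j, v i * v j * (μ[u i * u j | m]) y ^ 2 := by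
  have hG : ∀ᵐ y ∂μ, (Matrix.of fun i j => (μ[u i * u j | m]) y).PosSemidef := by
    refine ae_posSemidef (fun y => ?_) fun x => ?_
    · ext i j; simp [mul_comm]
    · filter_upwards [condExp_sq_sum_smul (m := m) hu x, condExp_nonneg (μ := μ) (m := m)
        (f := (∑ i, x i • u i) ^ 2) (Filter.Eventually.of_forall fun y => sq_nonneg _)] with y h1 h2
      rw [h1] at h2
      simp only [Pi.zero_apply] at h2
      simp only [dotProduct, mulVec, Matrix.of_apply, Finset.mul_sum]
      exact h2.trans_eq (Finset.sum_congr rfl fun i _ => Finset.sum_congr rfl fun j _ => by ring)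
  have hN : ∀ᵐ y ∂μ, (Matrix.of fun i j => C ^ 2 * (μ[u i * u j | m]) y
      - (μ[u i * ψ | m]) y * (μ[u j * ψ | m]) y).PosSemidef := by
    refine ae_posSemidef (fun y => ?_) fun x => ?_
    · ext i j; simp [mul_comm]
    · have hb : AEBdd μ (∑ i, |x i| * D) (∑ i, x i • u i) :=
        AEBdd.finsetSum fun i _ => (hu i).const_smul (x i)
      have e : (∑ i, x i • u i) * ψ = ∑ i, x i • (u i * ψ) := by
        rw [Finset.sum_mul]; simp only [smul_mul_assoc]
      filter_upwards [condExp_sq_sum_smul (m := m) hu x, condExp_mul_sq_le hm hb hψ,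
        condExp_sum_smul (μ := μ) (m := m) Finset.univ x (f := fun i => u i * ψ)
          fun i _ => ((hu i).mul hψ).integrable] with y h1 h2 h3
      rw [h1, e, h3, sq, Finset.sum_mul_sum, Finset.mul_sum] at h2
      simp only [dotProduct, mulVec, Matrix.of_apply, Finset.mul_sum]
      rw [← sub_nonneg, ← Finset.sum_sub_distrib] at h2
      refine h2.trans_eq (Finset.sum_congr rfl fun i _ => ?_)
      rw [Finset.mul_sum, ← Finset.sum_sub_distrib]
      exact Finset.sum_congr rfl fun j _ => by ring
  filter_upwards [hG, hN] with y hG hN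
  have := (hN.hadamard hG).dotProduct_mulVec_nonneg v
  simp only [dotProduct, mulVec, Matrix.hadamard_apply, Matrix.of_apply, Finset.mul_sum,
    star_trivial] at this
  rw [← sub_nonneg, Finset.mul_sum, ← Finset.sum_sub_distrib]
  refine le_of_le_of_eq this (Finset.sum_congr rfl fun i _ => ?_)
  rw [Finset.mul_sum, ← Finset.sum_sub_distrib]
  exact Finset.sum_congr rfl fun j _ => by ring

lemma condExp_sq_kernel (hm : m ≤ mX) (hu : ∀ i, AEBdd μ D (u i)) (hψ : AEBdd μ C ψ)
    (v : J → ℝ) :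
    μ[(∑ i, v i • (u i * μ[u i * ψ | m])) ^ 2 | m] =ᵐ[μ] fun y => ∑ i, ∑ j, v i * v j *
        ((μ[u i * ψ | m]) y * (μ[u j * ψ | m]) y * (μ[u i * u j | m]) y) := by
  have hp : ∀ i, AEBdd μ (D * C) (μ[u i * ψ | m]) := fun i => ((hu i).mul hψ).condExp hm
  have h1 := condExp_sq_sum_smul (m := m) (u := fun i => u i * μ[u i * ψ | m])
    (fun i => (hu i).mul (hp i)) v
  have h2 : ∀ᵐ y ∂μ, ∀ i j, (μ[(u i * μ[u i * ψ | m]) * (u j * μ[u j * ψ | m]) | m]) y =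
      (μ[u i * ψ | m]) y * (μ[u j * ψ | m]) y * (μ[u i * u j | m]) y := by
    refine ae_all_iff.2 fun i => ae_all_iff.2 fun j => ?_
    rw [show (u i * μ[u i * ψ | m]) * (u j * μ[u j * ψ | m]) =
      (μ[u i * ψ | m] * μ[u j * ψ | m]) * (u i * u j) by ring]
    exact condExp_mul_of_stronglyMeasurable_left
      (stronglyMeasurable_condExp.mul stronglyMeasurable_condExp)
      (((hp i).mul (hp j)).mul ((hu i).mul (hu j))).integrable ((hu i).mul (hu j)).integrable
  filter_upwards [h1, h2] with y h1 h2
  rw [h1]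
  simp only [h2]

end Fintype

variable {ι : Type*} {u : ι → X → ℝ} {ψ : X → ℝ}

lemma AEBdd.kernelOp (hm : m ≤ mX) (hu : ∀ i, AEBdd μ D (u i)) (hψ : AEBdd μ C ψ) (w : ι →₀ ℝ) :
    ∃ M, AEBdd μ M (kernelOp μ m u ψ w) := by
  rw [kernelOp_apply]
  exact ⟨_, AEBdd.finsetSum fun i _ =>
    ((hu i).mul (((hu i).mul hψ).condExp hm)).const_smul (w i)⟩

/-- Pointwise Hilbert–Schmidt bound for the operator with kernel `∑ i, w i • u i ⊗ u i`. -/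
lemma condExp_sq_kernelOp_le (hm : m ≤ mX) (hu : ∀ i, AEBdd μ D (u i)) (hψ : AEBdd μ C ψ)
    (w : ι →₀ ℝ) :
    ∀ᵐ y ∂μ, (μ[(kernelOp μ m u ψ w) ^ 2 | m]) y ≤
      C ^ 2 * finsuppForm (gramSq μ m u y) w w := by
  rw [kernelOp_apply]
  filter_upwards [condExp_sq_kernel hm (fun i : w.support => hu i) hψ (fun i => w i),
    ae_quadratic_le hm (fun i : w.support => hu i) hψ (fun i => w i)] with y h1 h2
  rw [h1, finsuppForm_apply]
  refine h2.trans_eq ?_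
  rw [← Finset.sum_coe_sort w.support]
  congr 1
  refine Finset.sum_congr rfl fun i _ => ?_
  rw [← Finset.sum_coe_sort w.support]
  rfl

/-- The operator bound with ψ = 0 and C = 1 already sandwiches 0 below the form. -/
lemma finsuppForm_gramSq_nonneg (hm : m ≤ mX) (hu : ∀ i, AEBdd μ D (u i)) (w : ι →₀ ℝ) :
    ∀ᵐ y ∂μ, 0 ≤ finsuppForm (gramSq μ m u y) w w := by
  have h1 : AEBdd μ 1 (fun _ : X => (0 : ℝ)) := ⟨aestronglyMeasurable_const, by simp⟩
  filter_upwards [condExp_sq_kernelOp_le hm hu h1 w, condExp_nonneg (μ := μ) (m := m)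
    (f := (kernelOp μ m u (fun _ => 0) w) ^ 2) (Filter.Eventually.of_forall fun y => sq_nonneg _)]
    with y h1 h2
  have := h2.trans h1
  simpa using this

lemma integrable_gramSq (hm : m ≤ mX) (hu : ∀ i, AEBdd μ D (u i)) (i j : ι) :
    Integrable (fun y => gramSq μ m u y i j) μ :=
  (((hu i).mul (hu j)).condExp hm).pow_two.integrable

lemma integrable_finsuppForm (hm : m ≤ mX) (hu : ∀ i, AEBdd μ D (u i)) (v w : ι →₀ ℝ) :
    Integrable (fun y => finsuppForm (gramSq μ m u y) v w) μ := by
  simp only [finsuppForm_apply]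
  exact integrable_finsetSum _ fun i _ => integrable_finsetSum _ fun j _ =>
    (integrable_gramSq hm hu i j).const_mul _

lemma integral_finsuppForm (hm : m ≤ mX) (hu : ∀ i, AEBdd μ D (u i)) (v w : ι →₀ ℝ) :
    ∫ y, finsuppForm (gramSq μ m u y) v w ∂μ = gramForm μ m u v w := by
  simp only [gramForm, finsuppForm_apply]
  rw [integral_finsetSum _ fun i _ => integrable_finsetSum _ fun j _ =>
    (integrable_gramSq hm hu i j).const_mul _]
  refine Finset.sum_congr rfl fun i _ => ?_
  rw [integral_finsetSum _ fun j _ => (integrable_gramSq hm hu i j).const_mul _]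
  exact Finset.sum_congr rfl fun j _ => integral_const_mul _ _

lemma gramForm_self_nonneg (hm : m ≤ mX) (hu : ∀ i, AEBdd μ D (u i)) (w : ι →₀ ℝ) :
    0 ≤ gramForm μ m u w w := by
  rw [← integral_finsuppForm hm hu]
  exact integral_nonneg_of_ae (finsuppForm_gramSq_nonneg hm hu w)

lemma integral_sq_kernelOp_le (hm : m ≤ mX) (hu : ∀ i, AEBdd μ D (u i)) (hψ : AEBdd μ C ψ)
    (w : ι →₀ ℝ) :
    ∫ x, kernelOp μ m u ψ w x ^ 2 ∂μ ≤ C ^ 2 * gramForm μ m u w w := by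
  rw [← integral_finsuppForm hm hu, ← integral_const_mul]
  calc _ = ∫ x, (μ[(kernelOp μ m u ψ w) ^ 2 | m]) x ∂μ := (integral_condExp hm).symm
    _ ≤ _ := integral_mono_ae integrable_condExp
      ((integrable_finsuppForm hm hu w w).const_mul _) (condExp_sq_kernelOp_le hm hu hψ w)

/-- The diagonal matrix coefficient of the operator is a weighted sum of squared relative
correlations. This links weights both to orthogonality against g and to averages of `relCorr`. -/
lemma integral_mul_kernelOp (hm : m ≤ mX) (hu : ∀ i, AEBdd μ D (u i)) (hψ : AEBdd μ C ψ)
    (w : ι →₀ ℝ) :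
    ∫ x, ψ x * kernelOp μ m u ψ w x ∂μ =
      ∑ i ∈ w.support, w i * ∫ x, (μ[u i * ψ | m]) x ^ 2 ∂μ := by
  have hp : ∀ i, AEBdd μ (D * C) (μ[u i * ψ | m]) := fun i => ((hu i).mul hψ).condExp hm
  have e : ∀ x, ψ x * kernelOp μ m u ψ w x =
      ∑ i ∈ w.support, w i * ((u i * ψ) x * (μ[u i * ψ | m]) x) := fun x => by
    rw [kernelOp, Finsupp.linearCombination_apply, Finsupp.sum, Finset.sum_apply, Finset.mul_sum]
    refine Finset.sum_congr rfl fun i _ => ?_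
    simp only [Pi.smul_apply, Pi.mul_apply, smul_eq_mul]; ring
  simp only [e]
  rw [integral_finsetSum (f := fun i x => w i * ((u i * ψ) x * (μ[u i * ψ | m]) x)) _
    fun i _ => ((((hu i).mul hψ).mul (hp i)).integrable.const_mul _)]
  refine Finset.sum_congr rfl fun i _ => ?_
  rw [integral_const_mul, integral_mul_condExp hm (((hu i).mul hψ).memLp 2)
    (((hu i).mul hψ).memLp 2)]
  simp only [sq]

end Kernel

/-! ### Minimizing a positive form over convex weights. -/

section Minimization

variable {V : Type*} [AddCommGroup V] [Module ℝ V] {b : V →ₗ[ℝ] V →ₗ[ℝ] ℝ} {K : Set V} {M r : ℝ}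

/-- Near-minimizers of a positive semidefinite quadratic form over a convex set are close. -/
lemma form_sub_le_of_near_min (hsymm : ∀ v w, b v w = b w v) (hK : Convex ℝ K)
    (hM : ∀ v ∈ K, M ≤ b v v) {v w : V} (hv : v ∈ K) (hw : w ∈ K) (hvr : b v v ≤ M + r)
    (hwr : b w w ≤ M + r) : b (v - w) (v - w) ≤ 4 * r := by
  -- Parallelogram law: b(v − w) = 2b(v) + 2b(w) − 4b((v + w)/2) ≤ 4(M + r) − 4M, writing b(v) for
  -- b(v, v).
  have hmid : (1 / 2 : ℝ) • v + (1 / 2 : ℝ) • w ∈ K :=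
    hK hv hw (by norm_num) (by norm_num) (by norm_num)
  have h := hM _ hmid
  have hs := hsymm v w
  simp only [map_add, map_sub, map_smul, LinearMap.add_apply, LinearMap.sub_apply,
    LinearMap.smul_apply, smul_eq_mul] at h ⊢
  linarith

/-- If a minimizing sequence over a convex set is asymptotically orthogonal to a point of the set,
then the infimum of the form is zero. -/
lemma min_nonpos_of_tendsto (hsymm : ∀ v w, b v w = b w v) (hK : Convex ℝ K)
    (hM : ∀ v ∈ K, M ≤ b v v) {w : ℕ → V} (hw : ∀ n, w n ∈ K)
    (hwM : Filter.Tendsto (fun n => b (w n) (w n)) Filter.atTop (nhds M)) {v : V} (hv : v ∈ K)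
    (h0 : Filter.Tendsto (fun n => b (w n) v) Filter.atTop (nhds 0)) : M ≤ 0 := by
  by_contra! hpos
  have hQ : M ≤ b v v := hM v hv
  have key : ∀ t : ℝ, 0 ≤ t → t ≤ 1 → M ≤ (1 - t) ^ 2 * M + t ^ 2 * b v v := fun t ht0 ht1 => by
    have hlim : Filter.Tendsto (fun n => (1 - t) ^ 2 * b (w n) (w n) +
        2 * t * (1 - t) * b (w n) v + t ^ 2 * b v v) Filter.atTop
        (nhds ((1 - t) ^ 2 * M + 2 * t * (1 - t) * 0 + t ^ 2 * b v v)) :=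
      ((hwM.const_mul _).add (h0.const_mul _)).add tendsto_const_nhds
    rw [mul_zero, add_zero] at hlim
    refine ge_of_tendsto' hlim fun n => ?_
    have h := hM _ (hK (hw n) hv (sub_nonneg.2 ht1) ht0 (by ring))
    have hs := hsymm v (w n)
    simp only [map_add, map_smul, LinearMap.add_apply, LinearMap.smul_apply, smul_eq_mul, hs] at h
    linarith
  have hp : 0 < M + b v v := by linarith
  -- This t minimizes (1 − t)²M + t² b(v, v); there the inequality reduces to 2M ≤ M, contradicting
  -- M > 0.
  have h := key (M / (M + b v v)) (by positivity) ((div_le_one hp).2 (by linarith))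
  have ht : M / (M + b v v) * (M + b v v) = M := div_mul_cancel₀ _ hp.ne'
  have htp : 0 < M / (M + b v v) := by positivity
  set t := M / (M + b v v)
  have : t * (2 * M) ≤ t * (t * (M + b v v)) := by linarith
  have := le_of_mul_le_mul_left this htp
  linarith

/-- The finitely supported convex weights on `ι`. -/
def convexWeights (ι : Type*) : Set (ι →₀ ℝ) :=
  {w | (∀ i, 0 ≤ w i) ∧ Finsupp.linearCombination ℝ (fun _ : ι => (1 : ℝ)) w = 1}

lemma convex_convexWeights (ι : Type*) : Convex ℝ (convexWeights ι) := by
  intro v hv w hw s t hs ht hst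
  refine ⟨fun i => ?_, ?_⟩
  · have h1 := hv.1 i
    have h2 := hw.1 i
    simp only [Finsupp.add_apply, Finsupp.smul_apply, smul_eq_mul]
    positivity
  · rw [map_add, map_smul, map_smul, hv.2, hw.2]
    simpa using hst

lemma single_mem_convexWeights {ι : Type*} (i : ι) : Finsupp.single i 1 ∈ convexWeights ι := by
  classical
  refine ⟨fun j => ?_, by simp⟩
  rw [Finsupp.single_apply]; split_ifs <;> norm_num

lemma mapDomain_mem_convexWeights {ι : Type*} {f : ι → ι} (hf : Function.Injective f) {w : ι →₀ ℝ}
    (hw : w ∈ convexWeights ι) : Finsupp.mapDomain f w ∈ convexWeights ι := by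
  refine ⟨fun j => ?_, ?_⟩
  · by_cases hj : j ∈ Set.range f
    · obtain ⟨i, rfl⟩ := hj
      rw [Finsupp.mapDomain_apply hf]; exact hw.1 i
    · rw [Finsupp.mapDomain_of_notMem_range _ _ hj]
  · rw [Finsupp.linearCombination_mapDomain]; exact hw.2

lemma sum_convexWeights {ι : Type*} {w : ι →₀ ℝ} (hw : w ∈ convexWeights ι) :
    ∑ i ∈ w.support, w i = 1 := by
  have := hw.2
  rw [Finsupp.linearCombination_apply, Finsupp.sum] at this
  simpa using this

lemma finsuppForm_mapDomain {ι : Type*} (c : ι → ι → ℝ) (f : ι → ι) (v w : ι →₀ ℝ) :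
    finsuppForm c (Finsupp.mapDomain f v) (Finsupp.mapDomain f w) =
      finsuppForm (fun i j => c (f i) (f j)) v w := by
  simp only [finsuppForm, Finsupp.linearCombination_mapDomain, Function.comp_def]
  induction v using Finsupp.induction_linear with
  | zero => simp
  | add v v' h h' => simp only [map_add, LinearMap.add_apply, h, h']
  | single i a =>
    simp only [Finsupp.linearCombination_single, LinearMap.smul_apply,
      Finsupp.linearCombination_mapDomain, Function.comp_def]

end Minimization

/-! ### L² limits and their fibrewise control. -/

section Limits

variable {X : Type*} {m mX : MeasurableSpace X} {μ : Measure X} {a : ℕ → X → ℝ}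

lemma norm_toLp_sq {f : X → ℝ} (hf : MemLp f 2 μ) : ‖hf.toLp f‖ ^ 2 = ∫ x, f x ^ 2 ∂μ := by
  rw [← real_inner_self_eq_norm_sq, L2.inner_def]
  refine integral_congr_ae ?_
  filter_upwards [hf.coeFn_toLp] with x hx
  rw [hx]; simp [sq]

lemma exists_L2_limit {A : ℝ} (ha : ∀ n, MemLp (a n) 2 μ)
    (h : ∀ n, ∫ x, (a (n + 1) x - a n x) ^ 2 ∂μ ≤ (A * (1 / 2) ^ n) ^ 2) (hA : 0 ≤ A) :
    ∃ φ, MemLp φ 2 μ ∧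
      Filter.Tendsto (fun n => ∫ x, (φ x - a n x) ^ 2 ∂μ) Filter.atTop (nhds 0) := by
  have hd : ∀ n, dist ((ha n).toLp (a n)) ((ha (n + 1)).toLp (a (n + 1))) ≤ A * (1 / 2) ^ n := by
    intro n
    rw [dist_comm, dist_eq_norm, ← MemLp.toLp_sub]
    refine abs_le_of_sq_le_sq' ?_ (by positivity) |>.2
    rw [norm_toLp_sq]
    exact h n
  obtain ⟨F, hF⟩ := cauchySeq_tendsto_of_complete (cauchySeq_of_le_geometric _ _ (by norm_num) hd)
  refine ⟨F, Lp.memLp F, ?_⟩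
  have h0 : Filter.Tendsto (fun n => ‖F - (ha n).toLp (a n)‖ ^ 2) Filter.atTop (nhds 0) := by
    have := ((tendsto_const_nhds (x := F)).sub hF).norm.pow 2
    simpa using this
  refine h0.congr fun n => ?_
  have e : F - (ha n).toLp (a n) = ((Lp.memLp F).sub (ha n)).toLp (⇑F - a n) := by
    rw [MemLp.toLp_sub (Lp.memLp F) (ha n), Lp.toLp_coeFn]
  rw [e, norm_toLp_sq]
  rfl

lemma condExp_le_on (hm : m ≤ mX) {s : Set X} (hs : MeasurableSet[m] s) {f g : X → ℝ}
    (hf : Integrable f μ) (hg : Integrable g μ) (h : ∀ᵐ x ∂μ, x ∈ s → f x ≤ g x) :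
    ∀ᵐ x ∂μ, x ∈ s → (μ[f | m]) x ≤ (μ[g | m]) x := by
  have h1 := condExp_indicator (m := m) hf hs
  have h2 := condExp_indicator (m := m) hg hs
  have h3 : μ[s.indicator f | m] ≤ᵐ[μ] μ[s.indicator g | m] := by
    refine condExp_mono (hf.indicator (hm s hs)) (hg.indicator (hm s hs)) ?_
    filter_upwards [h] with x hx
    by_cases hxs : x ∈ s
    · simpa [hxs] using hx hxs
    · simp [hxs]
  filter_upwards [h1, h2, h3] with x h1 h2 h3 hxs
  rw [h1, h2] at h3
  simpa [hxs] using h3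

lemma condExp_sq_add_le {f g h : X → ℝ} (hf : MemLp f 2 μ) (hg : MemLp g 2 μ)
    (e : h = f + g) :
    ∀ᵐ y ∂μ, (μ[h ^ 2 | m]) y ≤ 2 * (μ[f ^ 2 | m]) y + 2 * (μ[g ^ 2 | m]) y := by
  subst e
  have h1 : μ[(f + g) ^ 2 | m] ≤ᵐ[μ] μ[(2 : ℝ) • f ^ 2 + (2 : ℝ) • g ^ 2 | m] := by
    refine condExp_mono (hf.add hg).integrable_sq
      ((hf.integrable_sq.const_mul 2).add (hg.integrable_sq.const_mul 2)) ?_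
    refine Filter.Eventually.of_forall fun x => ?_
    simp only [Pi.pow_apply, Pi.add_apply, Pi.smul_apply, smul_eq_mul]
    nlinarith [sq_nonneg (f x - g x)]
  have h2 := condExp_add (μ := μ) (f := (2 : ℝ) • f ^ 2) (g := (2 : ℝ) • g ^ 2)
    (hf.integrable_sq.const_mul 2) (hg.integrable_sq.const_mul 2) m
  filter_upwards [h1, h2, condExp_smul (μ := μ) (2 : ℝ) (f ^ 2) m,
    condExp_smul (μ := μ) (2 : ℝ) (g ^ 2) m] with y h1 h2 h3 h4
  rw [h2, Pi.add_apply, h3, h4] at h1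
  exact h1

variable [IsProbabilityMeasure μ]

/-- The positive part of F − κ on s has integral at most 2∫E_n for every n, hence integral 0.
Convergence in mean is thus enough for an almost everywhere bound. -/
lemma ae_le_of_forall_le_add {s : Set X} (hs : MeasurableSet s) {F : X → ℝ} {E : ℕ → X → ℝ} {κ : ℝ}
    (hF : Integrable F μ) (hE : ∀ n, Integrable (E n) μ) (hE0 : ∀ n, 0 ≤ᵐ[μ] E n)
    (hlim : Filter.Tendsto (fun n => ∫ x, E n x ∂μ) Filter.atTop (nhds 0))
    (h : ∀ n, ∀ᵐ x ∂μ, x ∈ s → F x ≤ 2 * E n x + κ) : ∀ᵐ x ∂μ, x ∈ s → F x ≤ κ := by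
  set P : X → ℝ := s.indicator fun x => max (F x - κ) 0
  have hP : Integrable P μ :=
    ((hF.sub (integrable_const κ)).sup (integrable_const (0 : ℝ))).indicator hs
  have hP0 : 0 ≤ P := fun x => Set.indicator_nonneg (fun _ _ => le_max_right _ _) x
  have hle : ∀ n, ∫ x, P x ∂μ ≤ 2 * ∫ x, E n x ∂μ := fun n => by
    rw [← integral_const_mul]
    refine integral_mono_ae hP ((hE n).const_mul 2) ?_
    filter_upwards [h n, hE0 n] with x hx hx0
    simp only [Pi.zero_apply] at hx0
    by_cases hxs : x ∈ s
    · simp only [P, Set.indicator_of_mem hxs]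
      exact max_le (by linarith [hx hxs]) (by linarith)
    · simp only [P, Set.indicator_of_notMem hxs]; linarith
  have h2 : ∫ x, P x ∂μ ≤ 0 := by
    have := ge_of_tendsto' (hlim.const_mul 2) hle
    simpa using this
  have h3 := (integral_eq_zero_iff_of_nonneg hP0 hP).1 (le_antisymm h2 (integral_nonneg hP0))
  filter_upwards [h3] with x hx hxs
  simp only [P, Set.indicator_of_mem hxs, Pi.zero_apply] at hx
  have := le_max_left (F x - κ) 0
  linarith

/-- Fibrewise geometric increments control the fibrewise distance to the `L²` limit. -/
lemma condExp_sq_limit_le (hm : m ≤ mX) {θ : X → ℝ} (hθ : MemLp θ 2 μ)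
    (ha : ∀ n, MemLp (a n) 2 μ)
    (hlim : Filter.Tendsto (fun n => ∫ x, (θ x - a n x) ^ 2 ∂μ) Filter.atTop (nhds 0))
    {s : Set X} (hs : MeasurableSet[m] s) {A : ℝ} (hA : 0 ≤ A) {n₀ : ℕ}
    (h : ∀ n, n₀ ≤ n → ∀ᵐ y ∂μ, y ∈ s →
      (μ[(a (n + 1) - a n) ^ 2 | m]) y ≤ A * (1 / 8) ^ n) :
    ∀ᵐ y ∂μ, y ∈ s → (μ[(θ - a n₀) ^ 2 | m]) y ≤ 8 * A * (1 / 8) ^ n₀ := by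
  -- Each use of (x + y)² ≤ 2x² + 2y² costs a factor 2, which the ratio 1/8 absorbs: 2 + 2·4/8 = 3 ≤
  -- 4.
  have hfin : ∀ k n, n₀ ≤ n → ∀ᵐ y ∂μ, y ∈ s →
      (μ[(a (n + k) - a n) ^ 2 | m]) y ≤ 4 * A * (1 / 8) ^ n := by
    intro k
    induction k with
    | zero =>
      intro n _
      have : (a (n + 0) - a n) ^ 2 = 0 := by simp
      rw [this, condExp_zero]
      exact Filter.Eventually.of_forall fun y _ => by simp only [Pi.zero_apply]; positivity
    | succ k ih =>
      intro n hn
      filter_upwards [h n hn, ih (n + 1) (by omega), condExp_sq_add_le (m := m)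
        (h := a (n + (k + 1)) - a n) ((ha (n + 1)).sub (ha n))
        ((ha (n + 1 + k)).sub (ha (n + 1)))
        (by rw [show n + (k + 1) = n + 1 + k by ring]; abel)] with y h1 h2 h3 hy
      have h1 := h1 hy
      have h2 := h2 hy
      have : 0 ≤ A * (1 / 8 : ℝ) ^ n := by positivity
      rw [pow_succ (1 / 8 : ℝ) n] at h2
      linarith
  refine ae_le_of_forall_le_add (E := fun k => μ[(θ - a (n₀ + k)) ^ 2 | m]) (hm s hs)
    integrable_condExp (fun _ => integrable_condExp)
    (fun k => condExp_nonneg (Filter.Eventually.of_forall fun y => sq_nonneg _)) ?_ fun k => ?_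
  · simp only [integral_condExp hm]
    have := hlim.comp (Filter.tendsto_add_atTop_nat n₀)
    refine this.congr fun k => ?_
    simp only [Function.comp, Pi.pow_apply, Pi.sub_apply, add_comm]
  · filter_upwards [hfin k n₀ le_rfl, condExp_sq_add_le (m := m) (h := θ - a n₀)
      (hθ.sub (ha (n₀ + k))) ((ha (n₀ + k)).sub (ha n₀)) (by abel)] with y h1 h2 hy
    have := h1 hy
    linarith

/-- A set belonging to the factor on which a fast decreasing sequence of functions is eventually
geometrically small. -/
lemma exists_set_geometric (hm : m ≤ mX) {q : ℕ → X → ℝ} (hq : ∀ n, StronglyMeasurable[m] (q n))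
    (hqi : ∀ n, Integrable (q n) μ) (hq0 : ∀ n, 0 ≤ᵐ[μ] q n)
    (hqint : ∀ n, ∫ y, q n y ∂μ ≤ (1 / 16) ^ n) {ε : ℝ} (hε : 0 < ε) :
    ∃ n₀, ∀ n₁, n₀ ≤ n₁ → ∃ s, MeasurableSet[m] s ∧ 1 - ε < μ.real s ∧
      ∀ n, n₁ ≤ n → ∀ y ∈ s, q n y ≤ (1 / 8) ^ n := by
  -- Borel–Cantelli: by Markov, q_n exceeds 8⁻ⁿ on a set of measure at most 16⁻ⁿ/8⁻ⁿ = 2⁻ⁿ, and the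
  -- tail from n₁ on sums to at most 2·2^{-n₁} < ε.
  obtain ⟨n₀, hn₀⟩ := exists_pow_lt_of_lt_one (show 0 < ε / 2 by positivity)
    (show (1 / 2 : ℝ) < 1 by norm_num)
  refine ⟨n₀, fun n₁ hn₁ => ⟨(⋃ k, {y | (1 / 8 : ℝ) ^ (n₁ + k) < q (n₁ + k) y})ᶜ, ?_, ?_, ?_⟩⟩
  · refine (MeasurableSet.iUnion fun k => ?_).compl
    exact (hq (n₁ + k)).measurable measurableSet_Ioi
  · have hmeas : MeasurableSet (⋃ k, {y | (1 / 8 : ℝ) ^ (n₁ + k) < q (n₁ + k) y}) := by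
      refine MeasurableSet.iUnion fun k => ?_
      exact measurableSet_lt measurable_const ((hq (n₁ + k)).mono hm).measurable
    have hk : ∀ k, μ {y | (1 / 8 : ℝ) ^ (n₁ + k) < q (n₁ + k) y} ≤
        ENNReal.ofReal ((1 / 2) ^ n₁ * (1 / 2) ^ k) := fun k => by
      rw [← pow_add]
      set n := n₁ + k
      have h1 := mul_meas_ge_le_integral_of_nonneg (hq0 n) (hqi n) ((1 / 8) ^ n)
      have h2 : μ.real {y | (1 / 8 : ℝ) ^ n ≤ q n y} ≤ (1 / 2) ^ n := by
        have h3 := h1.trans (hqint n)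
        rw [show (1 / 16 : ℝ) ^ n = (1 / 8) ^ n * (1 / 2) ^ n by rw [← mul_pow]; norm_num] at h3
        exact le_of_mul_le_mul_left h3 (by positivity)
      refine (measure_mono fun y hy => ?_).trans
        ((ENNReal.le_ofReal_iff_toReal_le (measure_ne_top μ _) (by positivity)).2 h2)
      simp only [Set.mem_ofPred_eq] at hy ⊢
      exact hy.le
    have hsum : μ (⋃ k, {y | (1 / 8 : ℝ) ^ (n₁ + k) < q (n₁ + k) y}) ≤
        ENNReal.ofReal (2 * (1 / 2) ^ n₁) := by
      refine (measure_iUnion_le _).trans ((ENNReal.tsum_le_tsum hk).trans ?_)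
      rw [← ENNReal.ofReal_tsum_of_nonneg (fun k => by positivity)
        (summable_geometric_two.mul_left _), tsum_mul_left, tsum_geometric_two, mul_comm]
    have h2 : μ.real (⋃ k, {y | (1 / 8 : ℝ) ^ (n₁ + k) < q (n₁ + k) y}) ≤ 2 * (1 / 2) ^ n₁ :=
      ENNReal.toReal_le_of_le_ofReal (by positivity) hsum
    have h3 : (1 / 2 : ℝ) ^ n₁ ≤ (1 / 2) ^ n₀ :=
      pow_le_pow_of_le_one (by norm_num) (by norm_num) hn₁
    rw [probReal_compl_eq_one_sub hmeas]
    linarith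
  · intro n hn y hy
    simp only [Set.mem_compl_iff, Set.mem_iUnion, Set.mem_ofPred_eq, not_exists, not_lt] at hy
    obtain ⟨k, rfl⟩ := Nat.exists_eq_add_of_le hn
    exact hy k

end Limits

/-! ### Finite nets for images of finite rank kernel operators. -/

section Net

variable {X : Type*} {m mX : MeasurableSpace X} {μ : Measure X} [IsProbabilityMeasure μ]
  {C D : ℝ} {ι : Type*} {u : ι → X → ℝ}

/-- The images of uniformly bounded functions under a finite rank kernel operator are uniformly
approximated by finitely many functions, up to a partition belonging to the factor. -/
lemma exists_net_kernelOp (hm : m ≤ mX) (hu : ∀ i, AEBdd μ D (u i)) {w : ι →₀ ℝ}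
    (hw : w ∈ convexWeights ι) {θ : ℝ} (hθ : 0 < θ) (C : ℝ) :
    ∃ (k : ℕ) (h : Fin k → X → ℝ), (∀ l, MemLp (h l) 2 μ) ∧ ∀ ψ, AEBdd μ C ψ →
      ∃ E : Fin k → Set X, (∀ l, MeasurableSet[m] (E l) ∧
        ∀ᵐ x ∂μ, x ∈ E l → |kernelOp μ m u ψ w x - h l x| ≤ θ) ∧ ∀ᵐ y ∂μ, ∃ l, y ∈ E l := by
  have hD : 0 ≤ D := by
    by_contra! hD
    have hs := sum_convexWeights hw
    have : w.support = ∅ := Finset.eq_empty_of_forall_notMem fun i _ => by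
      have := (hu i).nonneg; linarith
    rw [this] at hs
    simp at hs
  -- The coefficients E(u_i ψ | m) take values in the box [−DC, DC], which is covered by finitely
  -- many balls of this radius whatever ψ is. The sets E l are the preimages of these balls; since
  -- the weights sum to 1, the resulting error is at most Dθ/(D + 1) ≤ θ.
  have hρ : 0 < θ / (D + 1) := by positivity
  obtain ⟨t, -, htf, ht⟩ := finite_cover_balls_of_compact
    (isCompact_closedBall (0 : w.support → ℝ) (D * C)) hρ
  set e := htf.toFinset.equivFin with he
  refine ⟨htf.toFinset.card,
    fun l => ∑ i : w.support, (w i * (e.symm l : w.support → ℝ) i) • u i, fun l => ?_, ?_⟩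
  · exact (AEBdd.finsetSum fun (i : w.support) _ =>
      (hu i).const_smul (w i * (e.symm l : w.support → ℝ) i)).memLp 2
  intro ψ hψ
  have hc : ∀ i, AEBdd μ (D * C) (μ[u i * ψ | m]) := fun i => ((hu i).mul hψ).condExp hm
  refine ⟨fun l => ⋂ i : w.support,
    (μ[u i * ψ | m]) ⁻¹' Metric.ball ((e.symm l : w.support → ℝ) i) (θ / (D + 1)),
    fun l => ⟨?_, ?_⟩, ?_⟩
  · exact MeasurableSet.iInter fun i =>
      stronglyMeasurable_condExp.measurable Metric.isOpen_ball.measurableSet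
  · have hall : ∀ᵐ x ∂μ, ∀ i : w.support, |u i x| ≤ D := ae_all_iff.2 fun i => (hu i).bound
    filter_upwards [hall] with x hx hxE
    simp only [Set.mem_iInter, Set.mem_preimage, Metric.mem_ball, Real.dist_eq] at hxE
    rw [kernelOp_apply, Finset.sum_apply, Finset.sum_apply, ← Finset.sum_sub_distrib]
    calc _ ≤ ∑ i : w.support, w i * θ := by
          refine (Finset.abs_sum_le_sum_abs _ _).trans (Finset.sum_le_sum fun i _ => ?_)
          have e1 : (w i • (u i * μ[u i * ψ | m])) x -
              ((w i * (e.symm l : w.support → ℝ) i) • u i) x =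
              w i * (u i x * ((μ[u i * ψ | m]) x - (e.symm l : w.support → ℝ) i)) := by
            simp only [Pi.smul_apply, Pi.mul_apply, smul_eq_mul]; ring
          rw [e1, abs_mul, abs_of_nonneg (hw.1 i), abs_mul]
          refine mul_le_mul_of_nonneg_left ?_ (hw.1 i)
          calc _ ≤ D * (θ / (D + 1)) := mul_le_mul (hx i) (hxE i).le (abs_nonneg _) hD
            _ ≤ (D + 1) * (θ / (D + 1)) := by gcongr; linarith
            _ = θ := by field_simp
      _ = θ := by
          rw [← Finset.sum_mul, Finset.sum_coe_sort w.support w, sum_convexWeights hw, one_mul]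
  · have hall : ∀ᵐ x ∂μ, ∀ i : w.support, |(μ[u i * ψ | m]) x| ≤ D * C :=
      ae_all_iff.2 fun i => (hc i).bound
    filter_upwards [hall] with y hy
    have hDC : 0 ≤ D * C := mul_nonneg hD hψ.nonneg
    have hmem : (fun i : w.support => (μ[u i * ψ | m]) y) ∈
        Metric.closedBall (0 : w.support → ℝ) (D * C) := by
      rw [mem_closedBall_zero_iff, pi_norm_le_iff_of_nonneg hDC]
      exact hy
    obtain ⟨τ, hτ, hyτ⟩ := Set.mem_iUnion₂.1 (ht hmem)
    refine ⟨e ⟨τ, htf.mem_toFinset.2 hτ⟩, ?_⟩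
    simp only [Equiv.symm_apply_apply, Set.mem_iInter, Set.mem_preimage]
    intro i
    exact (dist_le_pi_dist (fun i : w.support => (μ[u i * ψ | m]) y) τ i).trans_lt
      (Metric.mem_ball.1 hyτ)

end Net

/-! ### Weak mixing from orthogonality to relatively compact functions. -/

section Orbit

variable {X : Type*} {d : ℕ} {m mX : MeasurableSpace X} [AddAction (Fin d → ℤ) X]
  {μ : Measure X} [MeasurableConstVAdd (Fin d → ℤ) X] [VAddInvariantMeasure (Fin d → ℤ) X μ]
  {Γ : AddSubgroup (Fin d → ℤ)} {C D M : ℝ} {g ψ : X → ℝ}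

/-- The translates of `g` by the elements of `Γ`. -/
def orbit (Γ : AddSubgroup (Fin d → ℤ)) (g : X → ℝ) (S : Γ) : X → ℝ :=
  translate (S : Fin d → ℤ) g

lemma AEBdd.orbit (hg : AEBdd μ C g) (S : Γ) : AEBdd μ C (orbit Γ g S) := hg.translate _

variable [IsProbabilityMeasure μ]

lemma translate_orbit (R S : Γ) : translate (R : Fin d → ℤ) (orbit Γ g S) = orbit Γ g (R + S) := by
  rw [orbit, translate_add]; rfl

/-- Equivariance: translating the output amounts to translating both the input and the kernel, and
the latter is a relabelling of the weights. -/
lemma translate_kernelOp (hm : IsFactor d m) (hg : AEBdd μ D g) (hψ : AEBdd μ C ψ) (R : Γ)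
    (w : Γ →₀ ℝ) :
    translate (R : Fin d → ℤ) (kernelOp μ m (orbit Γ g) ψ w) =ᵐ[μ]
      kernelOp μ m (orbit Γ g) (translate (R : Fin d → ℤ) ψ) (Finsupp.mapDomain (R + ·) w) := by
  induction w using Finsupp.induction_linear with
  | zero => simp only [map_zero, Finsupp.mapDomain_zero]; rfl
  | add v w hv hw =>
    rw [map_add, Finsupp.mapDomain_add, map_add]
    exact hv.add hw
  | single S a =>
    rw [Finsupp.mapDomain_single]
    simp only [kernelOp, Finsupp.linearCombination_single]
    have h := condExp_translate hm (R : Fin d → ℤ) ((hg.orbit S).mul hψ).integrable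
    rw [translate_mul, translate_orbit] at h
    filter_upwards [h] with x hx
    simp only [Pi.smul_apply, Pi.mul_apply, hx]
    rw [← translate_orbit]
    rfl

lemma integral_gramSq_orbit (hm : IsFactor d m) (hg : AEBdd μ D g) (R S S' : Γ) :
    ∫ y, gramSq μ m (orbit Γ g) y (R + S) (R + S') ∂μ = ∫ y, gramSq μ m (orbit Γ g) y S S' ∂μ := by
  have h := condExp_translate hm (R : Fin d → ℤ) ((hg.orbit S).mul (hg.orbit S')).integrable
  rw [translate_mul, translate_orbit, translate_orbit] at h
  simp only [gramSq]
  rw [← integral_translate_sq (R : Fin d → ℤ) (μ[orbit Γ g S * orbit Γ g S' | m])]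
  exact integral_congr_ae (h.mono fun x hx => by simp only [hx])

lemma gramForm_orbit_mapDomain (hm : IsFactor d m) (hg : AEBdd μ D g) (R : Γ) (v w : Γ →₀ ℝ) :
    gramForm μ m (orbit Γ g) (Finsupp.mapDomain (R + ·) v) (Finsupp.mapDomain (R + ·) w) =
      gramForm μ m (orbit Γ g) v w := by
  rw [gramForm, finsuppForm_mapDomain]
  simp only [integral_gramSq_orbit hm hg]

/-- `L²` limits of kernel operators along a fast minimizing sequence of convex weights intertwine
the action, up to a vanishing error. -/
lemma tendsto_translate_kernelOp (hm : IsFactor d m) (hg : AEBdd μ D g)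
    (hM : ∀ v ∈ convexWeights Γ, M ≤ gramForm μ m (orbit Γ g) v v) {w : ℕ → Γ →₀ ℝ}
    (hw : ∀ n, w n ∈ convexWeights Γ)
    (hwM : ∀ n, gramForm μ m (orbit Γ g) (w n) (w n) ≤ M + (1 / 16) ^ n / 4) {φ : X → ℝ}
    (hφ : MemLp φ 2 μ) (hψ : AEBdd μ C ψ)
    (hlim : Filter.Tendsto (fun n => ∫ x, (φ x - kernelOp μ m (orbit Γ g) ψ (w n) x) ^ 2 ∂μ)
      Filter.atTop (nhds 0)) (R : Γ) :
    Filter.Tendsto (fun n => ∫ x, (translate (R : Fin d → ℤ) φ x -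
      kernelOp μ m (orbit Γ g) (translate (R : Fin d → ℤ) ψ) (w n) x) ^ 2 ∂μ)
      Filter.atTop (nhds 0) := by
  have hA : ∀ (ψ : X → ℝ), AEBdd μ C ψ → ∀ v, MemLp (kernelOp μ m (orbit Γ g) ψ v) 2 μ :=
    fun ψ hψ v => (AEBdd.kernelOp hm.le hg.orbit hψ v).choose_spec.memLp 2
  have hψR := hψ.translate (R : Fin d → ℤ)
  have hbound : ∀ n, ∫ x, (translate (R : Fin d → ℤ) φ x -
      kernelOp μ m (orbit Γ g) (translate (R : Fin d → ℤ) ψ) (w n) x) ^ 2 ∂μ ≤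
      2 * ∫ x, (φ x - kernelOp μ m (orbit Γ g) ψ (w n) x) ^ 2 ∂μ
        + 2 * (C ^ 2 * (1 / 16) ^ n) := fun n => by
    -- Translated weights have the same form value, so v is as nearly minimal as w n. The two are
    -- therefore close, and replacing one by the other costs at most C²·16⁻ⁿ.
    set v := Finsupp.mapDomain (R + ·) (w n) with hv
    have hvK : v ∈ convexWeights Γ := mapDomain_mem_convexWeights (add_right_injective R) (hw n)
    have hvM : gramForm μ m (orbit Γ g) v v ≤ M + (1 / 16) ^ n / 4 := by
      rw [hv, gramForm_orbit_mapDomain hm hg]; exact hwM n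
    have h1 := integral_sq_add_le
      (memLp_translate (hφ.sub (hA ψ hψ (w n))) (R : Fin d → ℤ)) (hA _ hψR (v - w n))
    have h2 := integral_sq_kernelOp_le hm.le hg.orbit hψR (v - w n) (u := orbit Γ g)
    have h3 := form_sub_le_of_near_min gramForm_comm (convex_convexWeights Γ) hM hvK (hw n) hvM
      (hwM n)
    have h4 : C ^ 2 * gramForm μ m (orbit Γ g) (v - w n) (v - w n) ≤ C ^ 2 * (1 / 16) ^ n :=
      mul_le_mul_of_nonneg_left (h3.trans_eq (by ring)) (sq_nonneg C)
    rw [integral_translate_sq] at h1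
    refine le_trans (le_of_eq ?_) (h1.trans (add_le_add le_rfl
      (mul_le_mul_of_nonneg_left (h2.trans h4) (by norm_num))))
    refine integral_congr_ae ?_
    filter_upwards [translate_kernelOp hm hg hψ R (w n)] with x hx
    simp only [map_sub, translate_sub, Pi.sub_apply, hx, ← hv]
    ring
  have h0 : Filter.Tendsto (fun n => 2 * ∫ x, (φ x - kernelOp μ m (orbit Γ g) ψ (w n) x) ^ 2 ∂μ
        + 2 * (C ^ 2 * (1 / 16 : ℝ) ^ n)) Filter.atTop (nhds (2 * 0 + 2 * (C ^ 2 * 0))) :=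
    (hlim.const_mul 2).add (((tendsto_pow_atTop_nhds_zero_of_lt_one (by norm_num)
      (by norm_num)).const_mul _).const_mul 2)
  simp only [mul_zero, add_zero] at h0
  exact squeeze_zero (fun n => integral_nonneg fun x => sq_nonneg _) hbound h0

/-- `L²` limits of kernel operators along a fast minimizing sequence of convex weights are compact
relative to the factor. -/
lemma isCompactRel_of_minimizing (hm : IsFactor d m) (hg : AEBdd μ D g)
    (hM : ∀ v ∈ convexWeights Γ, M ≤ gramForm μ m (orbit Γ g) v v) {w : ℕ → Γ →₀ ℝ}
    (hw : ∀ n, w n ∈ convexWeights Γ)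
    (hwM : ∀ n, gramForm μ m (orbit Γ g) (w n) (w n) ≤ M + (1 / 16) ^ n / 4) {φ : X → ℝ}
    (hφ : MemLp φ 2 μ) (hψ : AEBdd μ C ψ)
    (hlim : Filter.Tendsto (fun n => ∫ x, (φ x - kernelOp μ m (orbit Γ g) ψ (w n) x) ^ 2 ∂μ)
      Filter.atTop (nhds 0)) : IsCompactRel μ Γ m φ := by
  refine ⟨hφ, fun ε hε δ hδ => ?_⟩
  have hu : ∀ S, AEBdd μ D (orbit Γ g S) := hg.orbit
  -- This fibrewise size of the increment does not involve ψ. A set where it is geometrically small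
  -- hence controls the operators on all translates of ψ simultaneously.
  set q : ℕ → X → ℝ := fun n y =>
    finsuppForm (gramSq μ m (orbit Γ g) y) (w (n + 1) - w n) (w (n + 1) - w n) with hq
  have hqm : ∀ n, StronglyMeasurable[m] (q n) := fun n => by
    simp only [hq, finsuppForm_apply]
    refine Finset.stronglyMeasurable_fun_sum _ fun i _ =>
      Finset.stronglyMeasurable_fun_sum _ fun j _ => ?_
    exact (stronglyMeasurable_condExp.pow 2).const_mul _
  have hqint : ∀ n, ∫ y, q n y ∂μ ≤ (1 / 16) ^ n := fun n => by
    rw [hq, integral_finsuppForm hm.le hu]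
    have h1 : (1 / 16 : ℝ) ^ (n + 1) ≤ (1 / 16) ^ n :=
      pow_le_pow_of_le_one (by norm_num) (by norm_num) (Nat.le_succ n)
    have := form_sub_le_of_near_min gramForm_comm (convex_convexWeights Γ) hM (hw (n + 1)) (hw n)
      ((hwM (n + 1)).trans (by linarith)) (hwM n)
    linarith
  obtain ⟨n₀, hn₀⟩ := exists_set_geometric hm.le hqm (fun n => integrable_finsuppForm hm.le hu _ _)
    (fun n => finsuppForm_gramSq_nonneg hm.le hu _) hqint hε
  obtain ⟨n₁, hn₁, hn₁δ⟩ : ∃ n₁, n₀ ≤ n₁ ∧ 8 * C ^ 2 * (1 / 8) ^ n₁ < δ ^ 2 / 8 := by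
    have h0 : Filter.Tendsto (fun n => 8 * C ^ 2 * (1 / 8 : ℝ) ^ n) Filter.atTop
        (nhds (8 * C ^ 2 * 0)) :=
      (tendsto_pow_atTop_nhds_zero_of_lt_one (by norm_num) (by norm_num)).const_mul _
    rw [mul_zero] at h0
    exact ((Filter.eventually_ge_atTop n₀).and
      (h0.eventually_lt_const (show (0 : ℝ) < δ ^ 2 / 8 by positivity))).exists
  obtain ⟨s, hs, hsε, hsq⟩ := hn₀ n₁ hn₁
  obtain ⟨k, h, hh, hnet⟩ := exists_net_kernelOp hm.le hu (hw n₁) (show 0 < δ / 4 by positivity) C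
  -- The extra net element 0 serves those y ∈ s with R + y outside s, where the translated indicator
  -- vanishes.
  refine ⟨s, hs, hsε, k + 1, Fin.cons 0 h, fun l => ?_, fun R hR => ?_⟩
  · refine Fin.cases ?_ (fun l => ?_) l
    · exact MemLp.zero'
    · simpa using hh l
  have hψR := hψ.translate R
  have hA : ∀ n, MemLp (kernelOp μ m (orbit Γ g) (translate R ψ) (w n)) 2 μ :=
    fun n => (AEBdd.kernelOp hm.le hu hψR (w n)).choose_spec.memLp 2
  have hφR : MemLp (translate R φ) 2 μ := memLp_translate hφ R
  have hnear : ∀ᵐ y ∂μ, y ∈ s →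
      (μ[(translate R φ - kernelOp μ m (orbit Γ g) (translate R ψ) (w n₁)) ^ 2 | m]) y ≤
        8 * C ^ 2 * (1 / 8) ^ n₁ := by
    refine condExp_sq_limit_le hm.le (a := fun n => kernelOp μ m (orbit Γ g) (translate R ψ) (w n))
      hφR hA (tendsto_translate_kernelOp hm hg hM hw hwM hφ hψ hlim ⟨R, hR⟩) hs (sq_nonneg C)
      fun n hn => ?_
    filter_upwards [condExp_sq_kernelOp_le hm.le hu hψR (w (n + 1) - w n)] with y hy hys
    rw [map_sub] at hy
    exact hy.trans (mul_le_mul_of_nonneg_left (hsq n hn y hys) (sq_nonneg C))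
  obtain ⟨E, hE, hEcover⟩ := hnet _ hψR
  set A := kernelOp μ m (orbit Γ g) (translate R ψ) (w n₁) with hAdef
  have hsR : MeasurableSet[m] ((fun x : X => R +ᵥ x) ⁻¹' s) := hm.invariant R hs
  have hind : translate R (s.indicator φ) = ((fun x : X => R +ᵥ x) ⁻¹' s).indicator (translate R φ) :=
    rfl
  rw [hind]
  set s' := (fun x : X => R +ᵥ x) ⁻¹' s with hs'
  have hφs : MemLp (s'.indicator (translate R φ)) 2 μ := hφR.indicator (hm.le _ hsR)
  have hout : ∀ᵐ y ∂μ, y ∈ s'ᶜ → (μ[(s'.indicator (translate R φ) - 0) ^ 2 | m]) y ≤ 0 := by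
    have h1 := condExp_le_on hm.le hsR.compl (hφs.sub MemLp.zero).integrable_sq
      (integrable_const (0 : ℝ)) (Filter.Eventually.of_forall fun x hx => by
        simp only [Pi.sub_apply, Pi.zero_apply]
        rw [Set.indicator_of_notMem hx]; simp)
    filter_upwards [h1] with y hy hys
    have := hy hys
    rw [condExp_const hm.le] at this
    exact this
  have hin : ∀ᵐ y ∂μ, ∀ l, y ∈ s' ∩ E l → (μ[(s'.indicator (translate R φ) - h l) ^ 2 | m]) y ≤
      2 * (μ[(translate R φ - A) ^ 2 | m]) y + 2 * (δ / 4) ^ 2 := by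
    refine ae_all_iff.2 fun l => ?_
    have h1 := condExp_le_on hm.le (hsR.inter (hE l).1) (f := (s'.indicator (translate R φ) - h l) ^ 2)
      (g := (2 : ℝ) • (translate R φ - A) ^ 2 + fun _ => 2 * (δ / 4) ^ 2)
      (hφs.sub (hh l)).integrable_sq
      (((hφR.sub (hA n₁)).integrable_sq.const_mul 2).add (integrable_const _)) (by
        filter_upwards [(hE l).2] with x hx hxs
        have hx := sq_le_sq.2 ((hx hxs.2).trans (le_abs_self _))
        simp only [Pi.pow_apply, Pi.sub_apply, Pi.add_apply, Pi.smul_apply, smul_eq_mul,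
          Set.indicator_of_mem hxs.1]
        nlinarith [sq_nonneg ((translate R φ x - A x) - (A x - h l x))])
    have h2 := condExp_add (μ := μ) (f := (2 : ℝ) • (translate R φ - A) ^ 2)
      (g := fun _ => 2 * (δ / 4) ^ 2) ((hφR.sub (hA n₁)).integrable_sq.const_mul 2)
      (integrable_const _) m
    filter_upwards [h1, h2, condExp_smul (μ := μ) (2 : ℝ) ((translate R φ - A) ^ 2) m]
      with y h1 h2 h3 hy
    refine (h1 hy).trans_eq ?_
    rw [h2, Pi.add_apply, h3, condExp_const hm.le]
    rfl
  filter_upwards [hnear, hEcover, hout, hin] with y hy1 hy2 hy3 hy4 hys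
  by_cases hys' : y ∈ s'
  · obtain ⟨l, hl⟩ := hy2
    refine ⟨l.succ, ?_⟩
    rw [Fin.cons_succ, fibreNorm, Real.sqrt_lt' hδ]
    have h1 := hy4 l ⟨hys', hl⟩
    have h2 := hy1 hys
    refine lt_of_le_of_lt h1 ?_
    -- The squared fibre distance is below 2·δ²/8 + 2·(δ/4)² = 3δ²/8.
    nlinarith
  · refine ⟨0, ?_⟩
    rw [Fin.cons_zero, fibreNorm, Real.sqrt_lt' hδ]
    exact lt_of_le_of_lt (hy3 hys') (by positivity)

/-- If `g` is orthogonal to all functions that are `Γ`-compact relative to the factor, then `0` is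
in the closed convex hull of the `Γ`-translates of `g ⊗ g` in the relative Hilbert–Schmidt norm. -/
theorem exists_convexWeights_gramForm_lt (hm : IsFactor d m) (hg : AEBdd μ C g)
    (horth : ∀ φ, IsCompactRel μ Γ m φ → ∫ x, g x * φ x ∂μ = 0) {η : ℝ} (hη : 0 < η) :
    ∃ w ∈ convexWeights Γ, gramForm μ m (orbit Γ g) w w < η := by
  have hu : ∀ S, AEBdd μ C (orbit Γ g S) := hg.orbit
  set b := gramForm μ m (orbit Γ g) with hb
  set I : Set ℝ := (fun w => b w w) '' convexWeights Γ with hI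
  have hIne : I.Nonempty := ⟨_, _, single_mem_convexWeights 0, rfl⟩
  have hIbdd : BddBelow I := ⟨0, by rintro _ ⟨w, -, rfl⟩; exact gramForm_self_nonneg hm.le hu w⟩
  set M := sInf I
  have hM : ∀ v ∈ convexWeights Γ, M ≤ b v v := fun v hv => csInf_le hIbdd ⟨v, hv, rfl⟩
  have hex : ∀ n : ℕ, ∃ w ∈ convexWeights Γ, b w w < M + (1 / 16) ^ n / 4 := fun n => by
    obtain ⟨_, ⟨w, hw, rfl⟩, hlt⟩ := exists_lt_of_csInf_lt hIne
      (show M < M + (1 / 16) ^ n / 4 by have : (0 : ℝ) < (1 / 16) ^ n / 4 := by positivity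
                                        linarith)
    exact ⟨w, hw, hlt⟩
  choose w hw hwM using hex
  have hwM' := fun n => (hwM n).le
  have hA : ∀ v, MemLp (kernelOp μ m (orbit Γ g) g v) 2 μ :=
    fun v => (AEBdd.kernelOp hm.le hu hg v).choose_spec.memLp 2
  obtain ⟨φ, hφ, hlim⟩ := exists_L2_limit (A := C) (fun n => hA (w n)) (fun n => by
    have h1 : (1 / 16 : ℝ) ^ (n + 1) ≤ (1 / 16) ^ n :=
      pow_le_pow_of_le_one (by norm_num) (by norm_num) (Nat.le_succ n)
    have h2 := form_sub_le_of_near_min gramForm_comm (convex_convexWeights Γ) hM (hw (n + 1)) (hw n)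
      ((hwM' (n + 1)).trans (by linarith)) (hwM' n)
    have h3 := integral_sq_kernelOp_le hm.le hu hg (w (n + 1) - w n)
    rw [map_sub] at h3
    refine h3.trans ?_
    rw [mul_pow, ← pow_mul, mul_comm n 2, pow_mul]
    refine mul_le_mul_of_nonneg_left ?_ (sq_nonneg C)
    refine h2.trans ?_
    calc 4 * ((1 / 16 : ℝ) ^ n / 4) = (1 / 16) ^ n := by ring
      _ ≤ _ := pow_le_pow_left₀ (by norm_num) (by norm_num) n) hg.nonneg
  have hφc : IsCompactRel μ Γ m φ := isCompactRel_of_minimizing hm hg hM hw hwM' hφ hg hlim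
  have h0 := horth φ hφc
  -- The unit weight at 0 represents g ⊗ g itself. Its pairing with w n is ⟨g, A_n g⟩, with A_n the
  -- kernel operator of w n, and this tends to ⟨g, φ⟩ = 0.
  have hcross : ∀ n, b (w n) (Finsupp.single 0 1) =
      ∫ x, g x * kernelOp μ m (orbit Γ g) g (w n) x ∂μ := fun n => by
    rw [integral_mul_kernelOp hm.le hu hg, hb, gramForm, finsuppForm_apply,
      Finsupp.support_single _ one_ne_zero]
    refine Finset.sum_congr rfl fun S _ => ?_
    have : orbit Γ g 0 = g := by simp [orbit]
    rw [Finset.sum_singleton, Finsupp.single_eq_same, mul_one]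
    simp only [gramSq, this]
  have hcross0 : Filter.Tendsto (fun n => b (w n) (Finsupp.single 0 1)) Filter.atTop (nhds 0) := by
    refine squeeze_zero_norm (a := fun n => √(∫ x, g x ^ 2 ∂μ) *
      √(∫ x, (φ x - kernelOp μ m (orbit Γ g) g (w n) x) ^ 2 ∂μ)) (fun n => ?_) ?_
    · have h1 := abs_integral_mul_le (hg.memLp 2) (hφ.sub (hA (w n)))
      have h2 : ∫ x, g x * (φ - kernelOp μ m (orbit Γ g) g (w n)) x ∂μ =
          - b (w n) (Finsupp.single 0 1) := by
        rw [hcross]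
        simp only [Pi.sub_apply, mul_sub]
        have i1 : Integrable (fun x => g x * φ x) μ := (hg.memLp 2).integrable_mul hφ
        have i2 : Integrable (fun x => g x * kernelOp μ m (orbit Γ g) g (w n) x) μ :=
          (hg.memLp 2).integrable_mul (hA (w n))
        rw [integral_sub i1 i2, h0, zero_sub]
      rw [h2, abs_neg] at h1
      exact h1
    · have := ((Real.continuous_sqrt.tendsto _).comp hlim).const_mul (√(∫ x, g x ^ 2 ∂μ))
      simpa using this
  have hwlim : Filter.Tendsto (fun n => b (w n) (w n)) Filter.atTop (nhds M) := by
    have h1 : Filter.Tendsto (fun n : ℕ => M + (1 / 16 : ℝ) ^ n / 4) Filter.atTop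
        (nhds (M + 0 / 4)) := ((tendsto_pow_atTop_nhds_zero_of_lt_one (by norm_num)
      (by norm_num)).div_const 4).const_add M
    rw [zero_div, add_zero] at h1
    exact tendsto_of_tendsto_of_tendsto_of_le_of_le tendsto_const_nhds h1 (fun n => hM _ (hw n)) hwM'
  have hM0 := min_nonpos_of_tendsto gramForm_comm (convex_convexWeights Γ) hM hw hwlim
    (single_mem_convexWeights 0) hcross0
  obtain ⟨_, ⟨v, hv, rfl⟩, hlt⟩ := exists_lt_of_csInf_lt hIne (show M < η by linarith)
  exact ⟨v, hv, hlt⟩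

end Orbit

/-! ### From fibrewise compactness to compactness in mean. -/

section MeanCompact

variable {X : Type*} {d : ℕ} {m m' mX : MeasurableSpace X} [AddAction (Fin d → ℤ) X]
  {μ : Measure X} {Γ : AddSubgroup (Fin d → ℤ)} {C H : ℝ} {f g : X → ℝ}

/-- The `Γ`-orbit of `f` is, for every `δ`, within `δ` in (squared) `L²` norm of the bounded
combinations, with coefficients measurable over the factor, of finitely many bounded functions. -/
def IsMeanCompact (μ : Measure X) (Γ : AddSubgroup (Fin d → ℤ)) (m : MeasurableSpace X)
    (f : X → ℝ) : Prop :=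
  ∀ δ : ℝ, 0 < δ → ∃ (k : ℕ) (h : Fin k → X → ℝ) (H : ℝ), (∀ l, AEBdd μ H (h l)) ∧
    ∀ R ∈ Γ, ∃ c : Fin k → X → ℝ, (∀ l, StronglyMeasurable[m] (c l)) ∧ (∀ l x, |c l x| ≤ 1) ∧
      ∫ x, (translate R f x - ∑ l, c l x * h l x) ^ 2 ∂μ < δ

lemma IsMeanCompact.mono (hf : IsMeanCompact μ Γ m f) (h : m ≤ m') : IsMeanCompact μ Γ m' f := by
  intro δ hδ
  obtain ⟨k, u, H, hu, hR⟩ := hf δ hδ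
  refine ⟨k, u, H, hu, fun R hRΓ => ?_⟩
  obtain ⟨c, hc, hc1, hint⟩ := hR R hRΓ
  exact ⟨c, fun l => (hc l).mono h, hc1, hint⟩

lemma exists_aeBdd_integral_sq_sub_lt (hf : MemLp f 2 μ) {κ : ℝ} (hκ : 0 < κ) :
    ∃ (f' : X → ℝ) (H : ℝ), AEBdd μ H f' ∧ MemLp f' 2 μ ∧ ∫ x, (f x - f' x) ^ 2 ∂μ < κ := by
  obtain ⟨s, hs, hs2⟩ := hf.exists_simpleFunc_eLpNorm_sub_lt (by norm_num)
    (ε := ENNReal.ofReal √κ) (by simpa using hκ)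
  obtain ⟨H, hH⟩ := s.exists_forall_norm_le
  refine ⟨s, H, ⟨hs2.aestronglyMeasurable, Filter.Eventually.of_forall hH⟩, hs2, ?_⟩
  have h1 := norm_toLp_sq (hf.sub hs2)
  rw [Lp.norm_toLp] at h1
  simp only [Pi.sub_apply] at h1
  rw [← h1, ← Real.lt_sqrt ENNReal.toReal_nonneg]
  exact (ENNReal.lt_ofReal_iff_toReal_lt hs.ne_top).1 hs

variable [MeasurableConstVAdd (Fin d → ℤ) X] [VAddInvariantMeasure (Fin d → ℤ) X μ]
  [IsProbabilityMeasure μ]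

lemma integral_indicator_sq_le (hm : m ≤ mX) {E : Set X} (hE : MeasurableSet[m] E)
    (hf : MemLp f 2 μ) {δ : ℝ} (h : ∀ y ∈ E, fibreNorm μ m f y < δ) :
    ∫ x, E.indicator (fun x => f x ^ 2) x ∂μ ≤ δ ^ 2 * μ.real E := by
  rw [integral_indicator (hm E hE), ← setIntegral_condExp hm hf.integrable_sq hE]
  have h1 := setIntegral_mono_on (μ := μ) (s := E) (g := fun _ => δ ^ 2)
    (f := μ[fun x => f x ^ 2 | m]) integrable_condExp.integrableOn (integrable_const _).integrableOn
    (hm E hE) fun y hy => by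
      have h2 := h y hy
      have hδ : 0 < δ := (Real.sqrt_nonneg _).trans_lt h2
      exact ((Real.sqrt_lt' hδ).1 h2).le
  refine h1.trans_eq ?_
  rw [setIntegral_const, smul_eq_mul, mul_comm]

/-- Bounded relatively compact functions are compact in mean. -/
theorem IsCompactRel.isMeanCompact (hm : IsFactor d m) (hf : IsCompactRel μ Γ m f)
    (hfC : AEBdd μ C f) : IsMeanCompact μ Γ m f := by
  intro δ hδ
  have hC0 := hfC.nonneg
  -- Four errors, each at most δ/16: cutting f off to B, the fibrewise net, truncating the h l to
  -- bounded functions, and the part outside B. They enter with factors 3, 3, 3 and 1, and 10/16 <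
  -- 1.
  obtain ⟨B, hB, hBε, k, h, hh, hR⟩ := hf.2 (δ / (16 * (C ^ 2 + 1))) (by positivity)
    (√(δ / 16)) (by positivity)
  have hκ : 0 < δ / (16 * (k + 1)) := by positivity
  choose h' H hh' hh'2 hhint using fun l => exists_aeBdd_integral_sq_sub_lt (hh l) hκ
  refine ⟨k, h', ∑ l, |H l|, fun l => (hh' l).mono ((le_abs_self _).trans
    (Finset.single_le_sum (f := fun l => |H l|) (fun _ _ => abs_nonneg _) (Finset.mem_univ l))),
    fun R hRΓ => ?_⟩
  set F := translate R (B.indicator f) with hF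
  have hBX := hm.le B hB
  have hFC : AEBdd μ C (B.indicator f) := by
    refine ⟨hfC.aesm.indicator hBX, ?_⟩
    filter_upwards [hfC.bound] with x hx
    by_cases hxB : x ∈ B
    · rwa [Set.indicator_of_mem hxB]
    · rw [Set.indicator_of_notMem hxB, abs_zero]; exact hC0
  have hFC' : AEBdd μ C F := hFC.translate R
  have hfR := hfC.translate R
  -- Taking the first good index makes the sets disjoint, so their indicators are the coefficients
  -- and at most one net function is active at each point.
  set E : Fin k → Set X := fun l => {y | y ∈ B ∧ fibreNorm μ m (F - h l) y < √(δ / 16) ∧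
    ∀ j < l, ¬ fibreNorm μ m (F - h j) y < √(δ / 16)} with hEdef
  have hfN : ∀ l, MeasurableSet[m] {y | fibreNorm μ m (F - h l) y < √(δ / 16)} := fun l =>
    (Real.continuous_sqrt.comp_stronglyMeasurable
      (stronglyMeasurable_condExp (f := fun z => (F - h l) z ^ 2) (μ := μ))).measurable
      measurableSet_Iio
  have hEm : ∀ l, MeasurableSet[m] (E l) := fun l =>
    hB.inter ((hfN l).inter (by
      have : {y | ∀ j < l, ¬ fibreNorm μ m (F - h j) y < √(δ / 16)} =
        ⋂ j, ⋂ (_ : j < l), {y | fibreNorm μ m (F - h j) y < √(δ / 16)}ᶜ := by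
          ext y; simp
      change MeasurableSet[m] {y | ∀ j < l, ¬ fibreNorm μ m (F - h j) y < √(δ / 16)}
      rw [this]
      exact MeasurableSet.iInter fun j => MeasurableSet.iInter fun _ => (hfN j).compl))
  have hdisj : ∀ x l j, x ∈ E l → x ∈ E j → l = j := fun x l j hl hj => by
    rcases lt_trichotomy l j with h1 | h1 | h1
    · exact absurd hl.2.1 (hj.2.2 l h1)
    · exact h1
    · exact absurd hj.2.1 (hl.2.2 j h1)
  have hcover : ∀ᵐ y ∂μ, y ∈ B → ∃ l, y ∈ E l := by
    filter_upwards [hR R hRΓ] with y hy hyB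
    have hex := hy hyB
    classical
    obtain ⟨l, hl⟩ := hex
    let S : Finset (Fin k) := Finset.univ.filter fun l => fibreNorm μ m (F - h l) y < √(δ / 16)
    have hS : S.Nonempty := ⟨l, by simpa [S] using hl⟩
    refine ⟨S.min' hS, hyB, ?_, fun j hj hlt => ?_⟩
    · have := S.min'_mem hS
      simpa [S] using this
    · have : S.min' hS ≤ j := S.min'_le j (by simpa [S] using hlt)
      exact absurd hj (not_lt.2 this)
  refine ⟨fun l => (E l).indicator fun _ => 1, fun l => stronglyMeasurable_const.indicator (hEm l),
    fun l x => ?_, ?_⟩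
  · by_cases hx : x ∈ E l <;> simp [hx]
  have hpt : ∀ᵐ x ∂μ, (translate R f x - ∑ l, (E l).indicator (fun _ => (1 : ℝ)) x * h' l x) ^ 2 ≤
      3 * (translate R f x - F x) ^ 2 +
      3 * ∑ l, (E l).indicator (fun x => (F - h l) x ^ 2) x +
      3 * ∑ l, (h l x - h' l x) ^ 2 + Bᶜ.indicator (fun _ => C ^ 2) x := by
    filter_upwards [hcover, hfR.bound] with x hx hxC
    have n1 : 0 ≤ ∑ l, (E l).indicator (fun x => (F - h l) x ^ 2) x :=
      Finset.sum_nonneg fun l _ => Set.indicator_nonneg (fun _ _ => sq_nonneg _) x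
    have n2 : 0 ≤ ∑ l, (h l x - h' l x) ^ 2 := Finset.sum_nonneg fun l _ => sq_nonneg _
    have n3 : 0 ≤ Bᶜ.indicator (fun _ => C ^ 2) x := Set.indicator_nonneg (fun _ _ => sq_nonneg _) x
    by_cases hxE : ∃ l, x ∈ E l
    · obtain ⟨l, hl⟩ := hxE
      have e1 : ∑ j, (E j).indicator (fun _ => (1 : ℝ)) x * h' j x = h' l x := by
        rw [Finset.sum_eq_single l]
        · simp [hl]
        · intro j _ hj
          rw [Set.indicator_of_notMem fun hxj => hj (hdisj x j l hxj hl), zero_mul]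
        · simp
      have e2 : (F x - h l x) ^ 2 ≤ ∑ l, (E l).indicator (fun x => (F - h l) x ^ 2) x := by
        have := Finset.single_le_sum (f := fun l => (E l).indicator (fun x => (F - h l) x ^ 2) x)
          (fun l _ => Set.indicator_nonneg (fun _ _ => sq_nonneg _) x) (Finset.mem_univ l)
        simpa [hl] using this
      have e3 : (h l x - h' l x) ^ 2 ≤ ∑ l, (h l x - h' l x) ^ 2 :=
        Finset.single_le_sum (f := fun l => (h l x - h' l x) ^ 2) (fun l _ => sq_nonneg _)
          (Finset.mem_univ l)
      rw [e1]
      nlinarith [sq_nonneg ((translate R f x - F x) - (F x - h l x)),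
        sq_nonneg ((translate R f x - F x) - (h l x - h' l x)),
        sq_nonneg ((F x - h l x) - (h l x - h' l x))]
    · have hxB : x ∉ B := fun hB => hxE (hx hB)
      have e1 : ∑ j, (E j).indicator (fun _ => (1 : ℝ)) x * h' j x = 0 :=
        Finset.sum_eq_zero fun j _ => by
          rw [Set.indicator_of_notMem fun hxj => hxE ⟨j, hxj⟩, zero_mul]
      have e2 : translate R f x ^ 2 ≤ C ^ 2 := sq_le_sq.2 (hxC.trans (le_abs_self C))
      rw [e1, sub_zero, Set.indicator_of_mem (Set.mem_compl hxB)]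
      nlinarith [sq_nonneg (translate R f x - F x)]
  have hBc : μ.real Bᶜ < δ / (16 * (C ^ 2 + 1)) := by
    rw [probReal_compl_eq_one_sub hBX]; linarith
  have hC2 : C ^ 2 * μ.real Bᶜ ≤ δ / 16 := by
    calc _ ≤ (C ^ 2 + 1) * (δ / (16 * (C ^ 2 + 1))) :=
          mul_le_mul (by linarith) hBc.le measureReal_nonneg (by positivity)
      _ = _ := by field_simp
  have iBc : Integrable (Bᶜ.indicator fun _ => C ^ 2) μ :=
    (integrable_const _).indicator hBX.compl
  have I4 : ∫ x, Bᶜ.indicator (fun _ => C ^ 2) x ∂μ ≤ δ / 16 := by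
    rw [integral_indicator_const _ hBX.compl, smul_eq_mul, mul_comm]; exact hC2
  have i1 : Integrable (fun x => (translate R f x - F x) ^ 2) μ :=
    (hfR.sub hFC').pow_two.integrable
  have I1 : ∫ x, (translate R f x - F x) ^ 2 ∂μ ≤ δ / 16 := by
    refine le_trans ?_ I4
    have : ∀ x, (translate R f x - F x) ^ 2 = translate R (f - B.indicator f) x ^ 2 := fun x => rfl
    simp only [this]
    rw [integral_translate_sq]
    refine integral_mono_ae (hfC.sub hFC).pow_two.integrable iBc ?_
    filter_upwards [hfC.bound] with x hx
    by_cases hxB : x ∈ B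
    · simp [hxB]
    · simp only [Pi.sub_apply]
      rw [Set.indicator_of_notMem hxB, Set.indicator_of_mem (Set.mem_compl hxB), sub_zero]
      exact sq_le_sq.2 (hx.trans (le_abs_self C))
  have hFh : ∀ l, MemLp (F - h l) 2 μ := fun l => (hFC'.memLp 2).sub (hh l)
  have i2 : ∀ l, Integrable ((E l).indicator fun x => (F - h l) x ^ 2) μ := fun l =>
    (hFh l).integrable_sq.indicator (hm.le _ (hEm l))
  have I2 : ∫ x, ∑ l, (E l).indicator (fun x => (F - h l) x ^ 2) x ∂μ ≤ δ / 16 := by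
    rw [integral_finsetSum _ fun l _ => i2 l]
    calc _ ≤ ∑ l, (√(δ / 16)) ^ 2 * μ.real (E l) := Finset.sum_le_sum fun l _ =>
          integral_indicator_sq_le hm.le (hEm l) (hFh l) fun y hy => hy.2.1
      _ = δ / 16 * μ.real (⋃ l, E l) := by
          rw [← Finset.mul_sum, Real.sq_sqrt (by positivity), measureReal_iUnion_fintype]
          · intro l j hlj
            refine Set.disjoint_left.2 fun x hx hx' => hlj (hdisj x l j hx hx')
          · exact fun l => hm.le _ (hEm l)
      _ ≤ δ / 16 * 1 := mul_le_mul_of_nonneg_left measureReal_le_one (by positivity)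
      _ = _ := mul_one _
  have i3 : ∀ l, Integrable (fun x => (h l x - h' l x) ^ 2) μ := fun l =>
    ((hh l).sub (hh'2 l)).integrable_sq
  have I3 : ∫ x, ∑ l, (h l x - h' l x) ^ 2 ∂μ ≤ δ / 16 := by
    rw [integral_finsetSum _ fun l _ => i3 l]
    calc _ ≤ ∑ l : Fin k, δ / (16 * (k + 1)) := Finset.sum_le_sum fun l _ => (hhint l).le
      _ = k * (δ / (16 * (k + 1))) := by simp
      _ ≤ (k + 1) * (δ / (16 * (k + 1))) := by gcongr; linarith
      _ = _ := by field_simp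
  have i2s : Integrable (fun x => ∑ l, (E l).indicator (fun x => (F - h l) x ^ 2) x) μ :=
    integrable_finsetSum _ fun l _ => i2 l
  have i3s : Integrable (fun x => ∑ l, (h l x - h' l x) ^ 2) μ :=
    integrable_finsetSum _ fun l _ => i3 l
  have hfin := integral_mono_of_nonneg (Filter.Eventually.of_forall fun x => sq_nonneg _)
    ((((i1.const_mul 3).add (i2s.const_mul 3)).add (i3s.const_mul 3)).add iBc) hpt
  refine hfin.trans_lt ?_
  rw [integral_add' (((i1.const_mul 3).add (i2s.const_mul 3)).add (i3s.const_mul 3)) iBc,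
    integral_add' ((i1.const_mul 3).add (i2s.const_mul 3)) (i3s.const_mul 3),
    integral_add' (i1.const_mul 3) (i2s.const_mul 3), integral_const_mul, integral_const_mul,
    integral_const_mul]
  linarith

end MeanCompact

/-! ### Averaged relative correlations. -/

section Averages

variable {X : Type*} {d : ℕ} {m m₁ m₂ m₃ mX : MeasurableSpace X} [AddAction (Fin d → ℤ) X]
  {μ : Measure X} {Γ : AddSubgroup (Fin d → ℤ)} {T : Fin d → ℤ} {B C H : ℝ}
  {f g h : X → ℝ}

/-- The squared norm of the relative correlation `E(f · v g ∣ m)`. -/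
noncomputable def relCorr (μ : Measure X) (m : MeasurableSpace X) (g f : X → ℝ)
    (v : Fin d → ℤ) : ℝ := ∫ x, (μ[f * translate v g | m]) x ^ 2 ∂μ

lemma relCorr_nonneg (v : Fin d → ℤ) : 0 ≤ relCorr μ m g f v :=
  integral_nonneg fun _ => sq_nonneg _

variable [MeasurableConstVAdd (Fin d → ℤ) X] [VAddInvariantMeasure (Fin d → ℤ) X μ]
  [IsProbabilityMeasure μ]

lemma relCorr_le (hm : m ≤ mX) (hg : AEBdd μ C g) (hf : AEBdd μ B f) (v : Fin d → ℤ) :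
    relCorr μ m g f v ≤ (B * C) ^ 2 :=
  ((hf.mul (hg.translate v)).condExp hm).pow_two.integral_le

lemma relCorr_translate (hm : IsFactor d m) (hg : AEBdd μ C g) (hf : AEBdd μ B f)
    (r v : Fin d → ℤ) : relCorr μ m g (translate r f) (r + v) = relCorr μ m g f v := by
  have h := condExp_translate hm r (hf.mul (hg.translate v)).integrable
  rw [translate_mul, translate_add] at h
  rw [relCorr, relCorr, ← integral_translate_sq r (μ[f * translate v g | m])]
  exact integral_congr_ae (h.mono fun x hx => by simp only [hx])

/-- Coefficients measurable over m come out of the conditional expectation, so the correlation of f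
is controlled by those of the finitely many h l, uniformly in v. -/
lemma relCorr_le_of_approx (hm : m ≤ mX) (hg : AEBdd μ C g) (hf : AEBdd μ B f) {k : ℕ}
    {h c : Fin k → X → ℝ} (hh : ∀ l, AEBdd μ H (h l)) (hc : ∀ l, StronglyMeasurable[m] (c l))
    (hc1 : ∀ l x, |c l x| ≤ 1) {δ : ℝ} (hδ : ∫ x, (f x - ∑ l, c l x * h l x) ^ 2 ∂μ ≤ δ)
    (v : Fin d → ℤ) :
    relCorr μ m g f v ≤ 2 * (C ^ 2 * δ) + 2 * (k * ∑ l, relCorr μ m g (h l) v) := by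
  have hgv := hg.translate v
  have hcb : ∀ l, AEBdd μ 1 (c l) := fun l =>
    ⟨((hc l).mono hm).aestronglyMeasurable, Filter.Eventually.of_forall (hc1 l)⟩
  have hch : ∀ l, AEBdd μ (1 * H) (c l * h l) := fun l => (hcb l).mul (hh l)
  have hsum : AEBdd μ (∑ _l : Fin k, 1 * H) (∑ l, c l * h l) := AEBdd.finsetSum fun l _ => hch l
  have hrem := hf.sub hsum
  have h1 : μ[f * translate v g | m] =ᵐ[μ] μ[(f - ∑ l, c l * h l) * translate v g | m] +
      ∑ l, c l * μ[h l * translate v g | m] := by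
    have e : f * translate v g =
        (f - ∑ l, c l * h l) * translate v g + ∑ l, c l * (h l * translate v g) := by
      simp only [← mul_assoc, ← Finset.sum_mul]; ring
    have i1 : ∀ l, Integrable (c l * (h l * translate v g)) μ := fun l =>
      ((hcb l).mul ((hh l).mul hgv)).integrable
    have a1 := condExp_add (μ := μ) (hrem.mul hgv).integrable
      (integrable_finsetSum' Finset.univ fun l _ => i1 l) m
    have a2 := condExp_finsetSum (μ := μ) (s := Finset.univ) (fun l _ => i1 l) m
    have a3 : ∀ᵐ x ∂μ, ∀ l, (μ[c l * (h l * translate v g) | m]) x =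
        (c l * μ[h l * translate v g | m]) x := ae_all_iff.2 fun l =>
      condExp_mul_of_stronglyMeasurable_left (hc l) (i1 l) ((hh l).mul hgv).integrable
    rw [← e] at a1
    filter_upwards [a1, a2, a3] with x a1 a2 a3
    rw [a1, Pi.add_apply, a2, Pi.add_apply, Finset.sum_apply, Finset.sum_apply]
    simp only [a3]
  have hE : ∀ l, AEBdd μ (H * C) (μ[h l * translate v g | m]) := fun l =>
    ((hh l).mul hgv).condExp hm
  have hcE : ∀ l, AEBdd μ (1 * (H * C)) (c l * μ[h l * translate v g | m]) := fun l =>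
    (hcb l).mul (hE l)
  have hr : AEBdd μ _ (μ[(f - ∑ l, c l * h l) * translate v g | m]) :=
    (hrem.mul hgv).condExp hm
  have hs := AEBdd.finsetSum (s := Finset.univ) fun l _ => hcE l
  have h2 : relCorr μ m g f v ≤
      2 * ∫ x, (μ[(f - ∑ l, c l * h l) * translate v g | m]) x ^ 2 ∂μ +
      2 * ∫ x, (∑ l, c l * μ[h l * translate v g | m]) x ^ 2 ∂μ := by
    refine le_trans (le_of_eq (integral_congr_ae ?_))
      (integral_sq_add_le (hr.memLp 2) (hs.memLp 2))
    filter_upwards [h1] with x hx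
    rw [hx]; rfl
  have h3 : ∫ x, (μ[(f - ∑ l, c l * h l) * translate v g | m]) x ^ 2 ∂μ ≤ C ^ 2 * δ := by
    refine (integral_sq_condExp_le hm ((hrem.mul hgv).memLp 2)).trans ?_
    refine le_trans ?_ (mul_le_mul_of_nonneg_left hδ (sq_nonneg C))
    rw [← integral_const_mul]
    have e : ∀ x, f x - ∑ l, c l x * h l x = (f - ∑ l, c l * h l) x := fun x => by
      simp [Finset.sum_apply]
    simp only [e]
    refine integral_mono_ae (hrem.mul hgv).pow_two.integrable
      (hrem.pow_two.integrable.const_mul _) ?_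
    filter_upwards [hgv.bound] with x hx
    have := sq_le_sq.2 (hx.trans (le_abs_self C))
    simp only [Pi.mul_apply, mul_pow]
    rw [mul_comm]
    exact mul_le_mul_of_nonneg_right this (sq_nonneg _)
  have h4 : ∫ x, (∑ l, c l * μ[h l * translate v g | m]) x ^ 2 ∂μ ≤
      k * ∑ l, relCorr μ m g (h l) v := by
    simp only [relCorr]
    rw [← integral_finsetSum (f := fun l x => (μ[h l * translate v g | m]) x ^ 2) _
      fun l _ => (hE l).pow_two.integrable, ← integral_const_mul]
    refine integral_mono hs.pow_two.integrable
      ((integrable_finsetSum _ fun l _ => (hE l).pow_two.integrable).const_mul _) fun x => ?_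
    simp only [Finset.sum_apply, Pi.mul_apply]
    have h5 := sq_sum_le_card_mul_sum_sq (s := (Finset.univ : Finset (Fin k)))
      (f := fun l => c l x * (μ[h l * translate v g | m]) x)
    rw [Finset.card_univ, Fintype.card_fin] at h5
    refine h5.trans (mul_le_mul_of_nonneg_left (Finset.sum_le_sum fun l _ => ?_)
      (Nat.cast_nonneg k))
    rw [mul_pow]
    have : c l x ^ 2 ≤ 1 := (sq_le_one_iff_abs_le_one _).2 (hc1 l x)
    nlinarith [sq_nonneg ((μ[h l * translate v g | m]) x)]
  linarith

/-- By invariance v moves onto h, and the weighted sum becomes ⟨ψ, Aψ⟩ for ψ = (−v)h and A the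
kernel operator of w. Cauchy–Schwarz and the Hilbert–Schmidt bound conclude, uniformly in v. -/
lemma sum_relCorr_le (hm : IsFactor d m) (hg : AEBdd μ C g) (hh : AEBdd μ H h) (w : Γ →₀ ℝ)
    (v : Fin d → ℤ) :
    ∑ S ∈ w.support, w S * relCorr μ m g h ((S : Fin d → ℤ) + v) ≤
      H ^ 2 * √(gramForm μ m (orbit Γ g) w w) := by
  have hh' := hh.translate (-v)
  have hH := hh.nonneg
  have e : ∀ S : Γ, relCorr μ m g h ((S : Fin d → ℤ) + v) =
      ∫ x, (μ[orbit Γ g S * translate (-v) h | m]) x ^ 2 ∂μ := fun S => by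
    rw [← relCorr_translate hm hg hh (-v), relCorr, mul_comm]
    simp only [orbit]
    rw [show -v + ((S : Fin d → ℤ) + v) = S by abel]
  simp only [e]
  have hk := (AEBdd.kernelOp hm.le (hg.orbit (Γ := Γ)) hh' w).choose_spec.memLp 2
  rw [← integral_mul_kernelOp hm.le hg.orbit hh']
  refine (le_abs_self _).trans ((abs_integral_mul_le (hh'.memLp 2) hk).trans ?_)
  have h1 : √(∫ x, translate (-v) h x ^ 2 ∂μ) ≤ H := by
    rw [← Real.sqrt_sq hH]
    exact Real.sqrt_le_sqrt hh'.pow_two.integral_le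
  have h2 : √(∫ x, kernelOp μ m (orbit Γ g) (translate (-v) h) w x ^ 2 ∂μ) ≤
      H * √(gramForm μ m (orbit Γ g) w w) := by
    have h3 := Real.sqrt_le_sqrt (integral_sq_kernelOp_le hm.le hg.orbit hh' w (u := orbit Γ g))
    rwa [Real.sqrt_mul (sq_nonneg H), Real.sqrt_sq hH] at h3
  calc _ ≤ H * (H * √(gramForm μ m (orbit Γ g) w w)) :=
        mul_le_mul h1 h2 (Real.sqrt_nonneg _) hH
    _ = _ := by ring

/-- Shifting the window by one adds one term and drops another, a change of at most A. -/
lemma sum_range_shift_le {x : ℤ → ℝ} {A : ℝ} (h0 : ∀ i, 0 ≤ x i) (hA : ∀ i, x i ≤ A) (N : ℕ)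
    (j : ℤ) :
    ∑ i ∈ Finset.range N, x (i + j) ≤ ∑ i ∈ Finset.range N, x i + |(j : ℝ)| * A := by
  have hA0 : 0 ≤ A := (h0 0).trans (hA 0)
  have step : ∀ j : ℤ, ∑ i ∈ Finset.range N, x (i + (j + 1)) =
      ∑ i ∈ Finset.range N, x (i + j) + x (N + j) - x j := fun j => by
    have h1 := Finset.sum_range_succ' (fun i : ℕ => x (i + j)) N
    have h2 := Finset.sum_range_succ (fun i : ℕ => x (i + j)) N
    simp only [Nat.cast_zero, zero_add] at h1
    have h3 : ∑ i ∈ Finset.range N, x (i + (j + 1)) =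
        ∑ i ∈ Finset.range N, x ((i + 1 : ℕ) + j) :=
      Finset.sum_congr rfl fun i _ => by congr 1; push_cast; ring
    linarith
  induction j using Int.induction_on with
  | zero => simp
  | succ j ih =>
    have h1 := step j
    have e1 : |(((j : ℤ) + 1 : ℤ) : ℝ)| = |((j : ℤ) : ℝ)| + 1 := by
      push_cast; rw [abs_of_nonneg (by positivity), abs_of_nonneg (by positivity)]
    rw [e1]
    linarith [h0 j, hA (N + j)]
  | pred j ih =>
    have h1 := step (-j - 1)
    rw [sub_add_cancel] at h1
    have e1 : |((-(j : ℤ) - 1 : ℤ) : ℝ)| = |((-(j : ℤ) : ℤ) : ℝ)| + 1 := by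
      push_cast
      rw [abs_neg, abs_of_nonneg (show (0 : ℝ) ≤ j by positivity),
        show -(j : ℝ) - 1 = -(j + 1) by ring, abs_neg, abs_of_nonneg (by positivity)]
    rw [e1]
    linarith [h0 (N + (-j - 1)), hA (-j - 1)]

/-- Relative mixing: if `f` is `Γ`-compact in mean and `0` is in the closed convex hull of the
`⟨Γ, T⟩`-translates of `g ⊗ g`, then the averaged correlations of `f` and `T^{-i} g` vanish. -/
theorem exists_average_relCorr_lt (hm : IsFactor d m) (hf : AEBdd μ B f) (hg : AEBdd μ C g)
    (hfc : IsMeanCompact μ Γ m f)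
    (hgw : ∀ η : ℝ, 0 < η → ∃ w ∈ convexWeights ↥(Γ ⊔ AddSubgroup.zmultiples T),
      gramForm μ m (orbit (Γ ⊔ AddSubgroup.zmultiples T) g) w w < η) {ε : ℝ} (hε : 0 < ε) :
    ∃ n : ℕ, ∀ N : ℕ, n ≤ N →
      (1 / (N : ℝ)) * ∑ i ∈ Finset.range N, relCorr μ m g f (-((i : ℤ) • T)) < ε := by
  have hC0 := hg.nonneg
  obtain ⟨k, h, H, hh, hR⟩ := hfc (ε / (8 * (C ^ 2 + 1))) (by positivity)
  -- The weights are chosen after the net, so that the form can beat k²H²; both are fixed before the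
  -- length N of the average.
  obtain ⟨w, hw, hwη⟩ := hgw ((ε / (8 * (k ^ 2 * H ^ 2 + 1))) ^ 2) (by positivity)
  have hsplit : ∀ S : ↥(Γ ⊔ AddSubgroup.zmultiples T), ∃ R ∈ Γ, ∃ j : ℤ,
      R + j • T = (S : Fin d → ℤ) := fun S => by
    obtain ⟨R, hR, t, ht, e⟩ := AddSubgroup.mem_sup.1 S.2
    obtain ⟨j, rfl⟩ := AddSubgroup.mem_zmultiples_iff.1 ht
    exact ⟨R, hR, j, e⟩
  choose R hRΓ j hRj using hsplit
  set J : ℝ := ∑ S ∈ w.support, w S * |(j S : ℝ)| with hJ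
  set A : ℝ := (H * C) ^ 2 with hA
  -- For S = R + jT, translating by R turns the pair (f, −iT) into (Rf, S − (i + j)T). Then Rf is
  -- replaced by the net, which does not depend on R, and removing the shift j costs a boundary term
  -- independent of N. Averaging over S with the weights w afterwards brings in `sum_relCorr_le`.
  have hS : ∀ (S : ↥(Γ ⊔ AddSubgroup.zmultiples T)) (N : ℕ), ∑ i ∈ Finset.range N, relCorr μ m g f (-((i : ℤ) • T)) ≤
      N * (ε / 4) + 2 * (k * ∑ l, (∑ i ∈ Finset.range N,
        relCorr μ m g (h l) ((S : Fin d → ℤ) + -((i : ℤ) • T)) + |(j S : ℝ)| * A)) := fun S N => by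
    obtain ⟨c, hc, hc1, hint⟩ := hR (R S) (hRΓ S)
    have h1 : ∀ i : ℕ, relCorr μ m g f (-((i : ℤ) • T)) ≤ ε / 4 +
        2 * (k * ∑ l, relCorr μ m g (h l) ((S : Fin d → ℤ) + -(((i : ℤ) + j S) • T))) := fun i => by
      rw [← relCorr_translate hm hg hf (R S)]
      have h2 := relCorr_le_of_approx hm.le hg (hf.translate (R S)) hh hc hc1 hint.le
        (R S + -((i : ℤ) • T))
      have h3 : C ^ 2 * (ε / (8 * (C ^ 2 + 1))) ≤ ε / 8 := by
        calc _ ≤ (C ^ 2 + 1) * (ε / (8 * (C ^ 2 + 1))) := by gcongr; linarith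
          _ = _ := by field_simp
      have h4 : R S + -((i : ℤ) • T) = (S : Fin d → ℤ) + -(((i : ℤ) + j S) • T) := by
        rw [← hRj S, add_smul]; abel
      rw [h4] at h2 ⊢
      linarith
    refine (Finset.sum_le_sum fun i _ => h1 i).trans ?_
    rw [Finset.sum_add_distrib, Finset.sum_const, Finset.card_range, nsmul_eq_mul,
      ← Finset.mul_sum, ← Finset.mul_sum, Finset.sum_comm]
    have h5 : ∀ l, ∑ i ∈ Finset.range N, relCorr μ m g (h l) ((S : Fin d → ℤ) + -(((i : ℤ) + j S) • T)) ≤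
        ∑ i ∈ Finset.range N, relCorr μ m g (h l) ((S : Fin d → ℤ) + -((i : ℤ) • T)) + |(j S : ℝ)| * A :=
      fun l => sum_range_shift_le (x := fun i : ℤ => relCorr μ m g (h l) ((S : Fin d → ℤ) + -(i • T)))
        (fun _ => relCorr_nonneg _) (fun _ => relCorr_le hm.le hg (hh l) _) N (j S)
    gcongr with l
    exact h5 l
  have hsum1 := sum_convexWeights hw
  have hQ : k ^ 2 * (H ^ 2 * √(gramForm μ m (orbit (Γ ⊔ AddSubgroup.zmultiples T) g) w w)) ≤
      ε / 8 := by
    have h1 : √(gramForm μ m (orbit (Γ ⊔ AddSubgroup.zmultiples T) g) w w) ≤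
        ε / (8 * (k ^ 2 * H ^ 2 + 1)) := by
      refine (Real.sqrt_le_sqrt hwη.le).trans_eq (Real.sqrt_sq (by positivity))
    calc _ ≤ (k ^ 2 * H ^ 2 + 1) * (ε / (8 * (k ^ 2 * H ^ 2 + 1))) := by
          rw [← mul_assoc]; gcongr; linarith
      _ = _ := by field_simp
  have hN : ∀ N : ℕ, ∑ i ∈ Finset.range N, relCorr μ m g f (-((i : ℤ) • T)) ≤
      N * (ε / 2) + 2 * (k ^ 2 * (J * A)) := fun N => by
    have h1 : ∑ i ∈ Finset.range N, relCorr μ m g f (-((i : ℤ) • T)) ≤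
        ∑ S ∈ w.support, w S * (N * (ε / 4) + 2 * (k * ∑ l, (∑ i ∈ Finset.range N,
          relCorr μ m g (h l) ((S : Fin d → ℤ) + -((i : ℤ) • T)) + |(j S : ℝ)| * A))) := by
      calc _ = ∑ S ∈ w.support, w S * ∑ i ∈ Finset.range N, relCorr μ m g f (-((i : ℤ) • T)) := by
            rw [← Finset.sum_mul, hsum1, one_mul]
        _ ≤ _ := Finset.sum_le_sum fun S _ => mul_le_mul_of_nonneg_left (hS S N) (hw.1 S)
    have h2 : ∑ S ∈ w.support, w S * (N * (ε / 4) + 2 * (k * ∑ l, (∑ i ∈ Finset.range N,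
          relCorr μ m g (h l) ((S : Fin d → ℤ) + -((i : ℤ) • T)) + |(j S : ℝ)| * A))) =
        N * (ε / 4) + 2 * (k * ∑ l, (∑ i ∈ Finset.range N, ∑ S ∈ w.support,
          w S * relCorr μ m g (h l) ((S : Fin d → ℤ) + -((i : ℤ) • T)) + J * A)) := by
      simp only [mul_add, Finset.sum_add_distrib, ← Finset.sum_mul, hsum1, one_mul]
      congr 1
      simp only [Finset.mul_sum, Finset.sum_mul, hJ]
      congr 1
      · rw [Finset.sum_comm]
        refine Finset.sum_congr rfl fun l _ => ?_
        rw [Finset.sum_comm]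
        exact Finset.sum_congr rfl fun i _ => Finset.sum_congr rfl fun S _ => by ring
      · rw [Finset.sum_comm]
        exact Finset.sum_congr rfl fun i _ => Finset.sum_congr rfl fun S _ => by ring
    have h3 : ∑ l, (∑ i ∈ Finset.range N, ∑ S ∈ w.support,
          w S * relCorr μ m g (h l) ((S : Fin d → ℤ) + -((i : ℤ) • T)) + J * A) ≤
        ∑ _l : Fin k, (N * (H ^ 2 *
          √(gramForm μ m (orbit (Γ ⊔ AddSubgroup.zmultiples T) g) w w)) + J * A) := by
      refine Finset.sum_le_sum fun l _ => add_le_add ?_ le_rfl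
      calc _ ≤ ∑ _i ∈ Finset.range N, H ^ 2 *
            √(gramForm μ m (orbit (Γ ⊔ AddSubgroup.zmultiples T) g) w w) :=
            Finset.sum_le_sum fun i _ => sum_relCorr_le hm hg (hh l) w _
        _ = _ := by simp
    rw [Finset.sum_const, Finset.card_univ, Fintype.card_fin, nsmul_eq_mul] at h3
    have h4 := mul_le_mul_of_nonneg_left h3 (Nat.cast_nonneg (α := ℝ) k)
    have h5 := mul_le_mul_of_nonneg_left hQ (Nat.cast_nonneg (α := ℝ) N)
    rw [h2] at h1
    nlinarith
  -- From here on the boundary terms are less than Nε/2; taking n + 1 ensures N > 0.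
  obtain ⟨n, hn⟩ := exists_nat_gt (2 * (k ^ 2 * (J * A)) / (ε / 2))
  refine ⟨n + 1, fun N hnN => ?_⟩
  have hN0 : (0 : ℝ) < N := by exact_mod_cast (by omega : 0 < N)
  have hnN' : (n : ℝ) ≤ N := by exact_mod_cast (by omega : n ≤ N)
  rw [div_lt_iff₀ (by positivity)] at hn
  rw [one_div, inv_mul_lt_iff₀ hN0]
  have := hN N
  nlinarith

/-- Comparison of relative correlations over nested factors. -/
lemma integral_sq_corr_le (hm₁ : IsFactor d m₁) (hm₂ : IsFactor d m₂) (hm₃ : IsFactor d m₃)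
    (h12 : m₁ ≤ m₂) (hf : AEBdd μ B f) (hg : AEBdd μ C g) (v : Fin d → ℤ) :
    ∫ x, ((μ[f * translate v g | m₁]) x - (μ[f | m₁]) x * translate v (μ[g | m₁]) x) ^ 2 ∂μ ≤
      2 * relCorr μ m₂ (g - μ[g | m₃]) f v +
      2 * (B ^ 2 * ∫ x, ((μ[g | m₃]) x - (μ[g | m₁]) x) ^ 2 ∂μ) := by
  have hg1 := hg.condExp hm₁.le
  have hg3 := hg.condExp hm₃.le
  have h1 := hf.mul ((hg.sub hg3).translate v)
  have h2 := hf.mul ((hg3.sub hg1).translate v)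
  have h3 := hf.mul (hg1.translate v)
  -- Split g as (g − E(g | m₃)) + (E(g | m₃) − E(g | m₁)) + E(g | m₁). The translate of the last
  -- summand is measurable over m₁, so its contribution is exactly the subtracted product.
  have ae : ∀ᵐ x ∂μ, (μ[f * translate v g | m₁]) x - (μ[f | m₁]) x * translate v (μ[g | m₁]) x =
      (μ[f * translate v (g - μ[g | m₃]) | m₁]) x +
      (μ[f * translate v (μ[g | m₃] - μ[g | m₁]) | m₁]) x := by
    have e : f * translate v g = f * translate v (g - μ[g | m₃]) +
        f * translate v (μ[g | m₃] - μ[g | m₁]) + f * translate v (μ[g | m₁]) := by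
      simp only [translate_sub]; ring
    have a1 := condExp_add (μ := μ) (h1.add h2).integrable h3.integrable m₁
    have a2 := condExp_add (μ := μ) h1.integrable h2.integrable m₁
    have a3 := condExp_mul_of_stronglyMeasurable_right (μ := μ) (m := m₁) (f := f)
      (stronglyMeasurable_translate hm₁ v (stronglyMeasurable_condExp (f := g) (μ := μ)))
      h3.integrable hf.integrable
    rw [← e] at a1
    filter_upwards [a1, a2, a3] with x a1 a2 a3
    rw [a1, Pi.add_apply, a2, a3, Pi.add_apply, Pi.mul_apply]
    ring
  calc _ = ∫ x, ((μ[f * translate v (g - μ[g | m₃]) | m₁]) x +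
        (μ[f * translate v (μ[g | m₃] - μ[g | m₁]) | m₁]) x) ^ 2 ∂μ :=
        integral_congr_ae (ae.mono fun x hx => by simp only [hx])
    _ ≤ _ := integral_sq_add_le ((h1.condExp hm₁.le).memLp 2) ((h2.condExp hm₁.le).memLp 2)
    _ ≤ _ := by
        refine add_le_add (mul_le_mul_of_nonneg_left
          (integral_sq_condExp_mono h12 hm₂.le (h1.memLp 2)) (by norm_num))
          (mul_le_mul_of_nonneg_left ?_ (by norm_num))
        refine (integral_sq_condExp_le hm₁.le (h2.memLp 2)).trans ?_
        have e : ∫ x, ((μ[g | m₃]) x - (μ[g | m₁]) x) ^ 2 ∂μ =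
            ∫ x, translate v (μ[g | m₃] - μ[g | m₁]) x ^ 2 ∂μ := by
          rw [integral_translate_sq]; rfl
        rw [e, ← integral_const_mul]
        refine integral_mono_ae h2.pow_two.integrable
          (((hg3.sub hg1).translate v).pow_two.integrable.const_mul _) ?_
        filter_upwards [hf.bound] with x hx
        have := sq_le_sq.2 (hx.trans (le_abs_self B))
        simp only [Pi.mul_apply, mul_pow]
        exact mul_le_mul_of_nonneg_right this (sq_nonneg _)

/-- `g - E(g ∣ m)` is orthogonal to the square integrable functions measurable over the factor. -/
lemma integral_sub_condExp_mul_eq_zero (hm : m ≤ mX) (hg : AEBdd μ C g) {φ : X → ℝ}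
    (hφ : MemLp φ 2 μ) (hφm : AEStronglyMeasurable[m] φ μ) :
    ∫ x, (g - μ[g | m]) x * φ x ∂μ = 0 := by
  have i1 : Integrable (fun x => g x * φ x) μ := (hg.memLp 2).integrable_mul hφ
  have i2 : Integrable (fun x => (μ[g | m]) x * φ x) μ :=
    ((hg.condExp hm).memLp 2).integrable_mul hφ
  have h1 := condExp_mul_of_aestronglyMeasurable_right (μ := μ) (f := g) hφm i1 hg.integrable
  have h2 : ∫ x, (μ[g | m]) x * φ x ∂μ = ∫ x, g x * φ x ∂μ := by
    calc _ = ∫ x, (μ[g * φ | m]) x ∂μ := (integral_congr_ae h1).symm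
      _ = _ := integral_condExp hm
  simp only [Pi.sub_apply, sub_mul]
  rw [integral_sub i1 i2, h2, sub_self]

end Averages

/-! ### Pigeonhole for the energy and room for finitely many blocks. -/

section Ordinals

/-- A monotone function on `[0, A]` has a small increment on one of many consecutive steps. -/
lemma exists_small_increment {e : ℕ → ℝ} {A κ : ℝ} (h0 : 0 ≤ e 0) {N : ℕ} (hA : e N ≤ A)
    (hN : A < N * κ) : ∃ j < N, e (j + 1) - e j < κ := by
  by_contra! hcon
  have h1 := Finset.sum_range_sub e N
  have h2 : ∑ j ∈ Finset.range N, κ ≤ ∑ j ∈ Finset.range N, (e (j + 1) - e j) :=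
    Finset.sum_le_sum fun j hj => hcon j (Finset.mem_range.1 hj)
  rw [Finset.sum_const, Finset.card_range, nsmul_eq_mul] at h2
  linarith

/-- Since α + 1 ≤ α·2, the product is at most α·(2N), and 2N < ω ≤ α. This is where the exponent 2
comes from. -/
lemma add_one_mul_nat_le_sq {α : Ordinal.{v}} (hα : Ordinal.omega0 ≤ α) (N : ℕ) :
    (α + 1) * (N : Ordinal.{v}) ≤ α ^ 2 := by
  have h1 : (1 : Ordinal.{v}) ≤ α := (Ordinal.one_lt_omega0.le).trans hα
  have h2 : α + 1 ≤ α * 2 := by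
    rw [show (2 : Ordinal.{v}) = 1 + 1 from one_add_one_eq_two.symm, mul_add, mul_one]
    exact add_le_add le_rfl h1
  calc (α + 1) * (N : Ordinal.{v}) ≤ α * 2 * N := mul_le_mul_left h2 _
    _ = α * ((2 * N : ℕ) : Ordinal.{v}) := by rw [mul_assoc]; push_cast; rfl
    _ ≤ α * α := mul_le_mul_right ((Ordinal.natCast_lt_omega0 _).le.trans hα) _
    _ = α ^ 2 := (sq α).symm

end Ordinals

end ErgodicTower

/-! ### Assembly of the main theorem. -/

open ErgodicTower in
theorem mainTheorem8 (ε : ℝ) (hε : 0 < ε) (B : ℝ) (hB : 0 < B) :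
    ∃ K : ℕ,
      ∀ (d : ℕ) (X : Type u) [MeasurableSpace X] (μ : Measure X) [IsProbabilityMeasure μ]
        [AddAction (Fin d → ℤ) X] [MeasurableConstVAdd (Fin d → ℤ) X]
        [VAddInvariantMeasure (Fin d → ℤ) X μ]
        (Γ : AddSubgroup (Fin d → ℤ)) (T : Fin d → ℤ) (_hT : T ∉ Γ)
        (η : Ordinal.{v}) (Y : Ordinal.{v} → MeasurableSpace X)
        (_hY : ErgodicTower.IsCompactTower μ (Γ ⊔ AddSubgroup.zmultiples T) η Y)
        (α : Ordinal.{v}) (_hα : Ordinal.omega0 ≤ α)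
        (s : Ordinal.{v} → Ordinal.{v}) (_hs : ErgodicTower.IsSeq (α ^ K) s)
        (_hsη : ∀ β ≤ α ^ K, s β < η)
        (f g : X → ℝ)
        (_hf : ErgodicTower.IsCompactRel μ Γ (Y 0) f)
        (_hg : ErgodicTower.IsCompactRel μ Γ (Y 0) g)
        (_hfB : eLpNorm f ⊤ μ ≤ ENNReal.ofReal B)
        (_hgB : eLpNorm g ⊤ μ ≤ ENNReal.ofReal B),
        ∃ (n : ℕ) (t : Ordinal.{v} → Ordinal.{v}),
          ErgodicTower.IsSubseq α t (α ^ K) s ∧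
          ErgodicTower.HoldsForMany α t (fun δ =>
            ∀ m : ℕ, n ≤ m →
              (1 / (m : ℝ)) * ∑ i ∈ Finset.range m,
                ∫ x, ((μ[f * ErgodicTower.translate (-((i : ℤ) • T)) g | Y δ]) x
                  - (μ[f | Y δ]) x
                    * ErgodicTower.translate (-((i : ℤ) • T)) (μ[g | Y δ]) x) ^ 2 ∂μ < ε) := by
  refine ⟨2, fun d X mX μ _ _ _ _ Γ T _ η Y hY α hα s hs hsη f g hf hg hfB hgB => ?_⟩
  have hf' : AEBdd μ B f := aeBdd_of_eLpNorm_top_le hf.1 hB.le hfB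
  have hg' : AEBdd μ B g := aeBdd_of_eLpNorm_top_le hg.1 hB.le hgB
  have hg2 : MemLp g 2 μ := hg.1
  have hmono : ∀ β γ, β ≤ γ → γ < η → Y β ≤ Y γ := fun β γ h hγ => by
    rcases h.eq_or_lt with rfl | h
    · exact le_rfl
    · exact hY.mono β γ h hγ
  have hfac := hY.factor
  set e : Ordinal.{v} → ℝ := fun β => ∫ x, (μ[g | Y β]) x ^ 2 ∂μ with he
  have he_mono : ∀ β γ, β ≤ γ → γ < η → e β ≤ e γ := fun β γ h hγ =>
    integral_sq_condExp_mono (hmono β γ h hγ) (hfac γ hγ).le hg2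
  -- N increments of size ε/(4B²) would exceed the total energy B².
  obtain ⟨N, hN⟩ := exists_nat_gt (B ^ 2 / (ε / (4 * B ^ 2)))
  rw [div_lt_iff₀ (by positivity)] at hN
  have hblock : ∀ j ≤ N, (α + 1) * (j : Ordinal.{v}) ≤ α ^ 2 := fun j _ => add_one_mul_nat_le_sq hα j
  have hstep : ∀ j : ℕ, (α + 1) * ((j + 1 : ℕ) : Ordinal.{v}) = (α + 1) * j + (α + 1) :=
    fun j => by push_cast; rw [mul_add, mul_one]
  obtain ⟨j, hjN, hj⟩ := exists_small_increment (e := fun j : ℕ => e (s ((α + 1) * j)))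
    (A := B ^ 2) (integral_nonneg fun _ => sq_nonneg _)
    (((hg'.condExp (hfac _ (hsη _ (hblock N le_rfl))).le).pow_two).integral_le) hN
  set a : Ordinal.{v} := (α + 1) * j with ha
  have htop : a + (α + 1) ≤ α ^ 2 := by rw [ha, ← hstep]; exact hblock (j + 1) hjN
  rw [hstep, ← ha] at hj
  have haα : a + α < a + (α + 1) := (add_lt_add_iff_left a).2 (lt_add_one α)
  have hle : ∀ β ≤ α, a + β ≤ α ^ 2 := fun β hβ =>
    ((add_le_add le_rfl hβ).trans haα.le).trans htop
  -- The block has one step more than t needs, so that Y_{l+1} still lies below its end and the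
  -- small energy increment covers it.
  set l := s (a + α) with hl
  have hl1 : l + 1 ≤ s (a + (α + 1)) :=
    Order.add_one_le_of_lt (hs (hle α le_rfl) htop haα)
  have hl1η : l + 1 < η := hl1.trans_lt (hsη _ htop)
  have hlη : l < η := hsη _ (hle α le_rfl)
  have hmeanc : IsMeanCompact μ Γ (Y l) f :=
    (hf.isMeanCompact (hfac 0 (zero_le.trans_lt hlη)) hf').mono (hmono 0 l zero_le hlη)
  -- A function compact relative to Y_l is measurable over Y_{l+1} by the tower hypothesis, hence
  -- orthogonal to g − E(g | Y_{l+1}).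
  have hweights : ∀ κ : ℝ, 0 < κ → ∃ w ∈ convexWeights ↥(Γ ⊔ AddSubgroup.zmultiples T),
      gramForm μ (Y l) (orbit (Γ ⊔ AddSubgroup.zmultiples T) (g - μ[g | Y (l + 1)])) w w < κ :=
    fun κ hκ => exists_convexWeights_gramForm_lt (hfac l hlη) (hg'.sub_condExp (hfac _ hl1η).le)
      (fun φ hφ => integral_sub_condExp_mul_eq_zero (hfac _ hl1η).le hg' hφ.1
        (hY.compact_le l hl1η φ hφ)) hκ
  obtain ⟨n, hn⟩ := exists_average_relCorr_lt (hfac l hlη) hf' (hg'.sub_condExp (hfac _ hl1η).le)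
    hmeanc hweights (show 0 < ε / 4 by positivity)
  refine ⟨n, fun β => s (a + β), ⟨fun β hβ γ hγ h => hs (hle β hβ) (hle γ hγ)
    ((add_lt_add_iff_left a).2 h), fun b hb => ⟨a + b, hle b hb, rfl⟩⟩, fun β hβ => ?_⟩
  have hβ1 : β + 1 ≤ α := Order.add_one_le_of_lt hβ
  -- The right endpoint of each interval of t serves as δ; n depends only on l and was fixed
  -- beforehand.
  refine ⟨s (a + (β + 1)), ⟨hs (hle β hβ.le) (hle _ hβ1)
    ((add_lt_add_iff_left a).2 (lt_add_one β)), le_rfl⟩, fun m hm => ?_⟩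
  set δ := s (a + (β + 1)) with hδ
  have hδl : δ ≤ l := hs.monotoneOn (hle _ hβ1) (hle α le_rfl) (add_le_add le_rfl hβ1)
  have haδ : s a ≤ δ := hs.monotoneOn (by simpa using hle 0 zero_le) (hle _ hβ1)
    (le_add_of_nonneg_right zero_le)
  have hδη : δ < η := hδl.trans_lt hlη
  have hδl1 : δ ≤ l + 1 := hδl.trans (lt_add_one l).le
  have henergy : ∫ x, ((μ[g | Y (l + 1)]) x - (μ[g | Y δ]) x) ^ 2 ∂μ < ε / (4 * B ^ 2) := by
    rw [integral_sq_condExp_sub (hmono _ _ hδl1 hl1η) (hfac _ hl1η).le hg2]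
    have h1 := he_mono _ _ hl1 (hsη _ htop)
    have h2 := he_mono _ _ haδ hδη
    simp only [he] at h1 h2 hj
    linarith
  have hBε : B ^ 2 * ∫ x, ((μ[g | Y (l + 1)]) x - (μ[g | Y δ]) x) ^ 2 ∂μ ≤ ε / 4 := by
    calc _ ≤ B ^ 2 * (ε / (4 * B ^ 2)) := mul_le_mul_of_nonneg_left henergy.le (sq_nonneg B)
      _ = _ := by field_simp
  rcases Nat.eq_zero_or_pos m with rfl | hm0
  · simpa using hε
  have hm0' : (0 : ℝ) < m := by exact_mod_cast hm0
  -- After averaging, the mixing term contributes less than 2·ε/4 and the energy gap at most 2·ε/4.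
  have hsum := Finset.sum_le_sum fun i (_ : i ∈ Finset.range m) =>
    integral_sq_corr_le (hfac δ hδη) (hfac l hlη) (hfac _ hl1η) (hmono _ _ hδl hlη) hf' hg'
      (-((i : ℤ) • T))
  have hlt := hn m hm
  rw [Finset.sum_add_distrib, ← Finset.mul_sum, Finset.sum_const, Finset.card_range,
    nsmul_eq_mul] at hsum
  rw [one_div, inv_mul_lt_iff₀ hm0'] at hlt ⊢
  have := mul_le_mul_of_nonneg_left hBε hm0'.le
  linarith
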